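/- **Proposition 1.5.** Let $\mathbb S^2\subset\mathbb R^3$ be the unit sphere with its Riemannian distance $d_{S^2}(x,y)=\arccos\langle x,y\rangle$, let $H^2=\{x\in\mathbb S^2: x_3\ge 0\}$ be the closed hemisphere and $S^1=\{x\in\mathbb S^2 : x_3=0\}$ its boundary circle, both with the restricted (equivalently, intrinsic length) metric. Let $\mathcal P_1(S^1)$ be the Wasserstein-$1$-space over $S^1$: the set of Borel probability measures on $S^1$ (at finite distance from Dirac measures, which is automatic here) with $$d_W(\mu,\nu)=\inf_{K}\int_{S^1\times S^1} d(x,y)\,\mathrm dK(x,y),$$ the infimum being over all couplings $K$ of $\mu$ and $\nu$, i.e. measures on $S^1\times S^1$ with marginals $\mu$ and $\nu$. For $P\in H^2\setminus S^1$ let $d_P:S^1\to\mathbb R$, $d_P(Q)=d_{S^2}(P,Q)$, let $d_P''$ be its second derivative with respect to arc length on $S^1$, and let $k_P=\cos\big(d_{S^2}(P,S^1)\big)$, where $d_{S^2}(P,S^1)=\inf_{Q\in S^1}d_{S^2}(P,Q)$. Then there exists an isometric embedding $\iota:H^2\to\mathcal P_1(S^1)$, that is, a map with $d_W(\iota(P),\iota(P'))=d_{S^2}(P,P')$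 for all $P,P'\in H^2$, such that $\iota(P)=\delta_P$ for all $P\in S^1$. Moreover $\iota$ can be chosen so that for every $P\in H^2\setminus S^1$ the measure $\iota(P)$ has density $$\tfrac12\,(d_P'')^+ +\frac{1-k_P}{2\pi}$$ with respect to the one-dimensional Hausdorff measure $\mathcal H^1_{S^1}$ on $S^1$. -/

import Mathlib

open MeasureTheory

noncomputable section

/-- The set of couplings of `μ` and `ν`. -/
def couplings {X : Type*} [MeasurableSpace X] (μ ν : Measure X) : Set (Measure (X × X)) :=
  {K | K.map Prod.fst = μ ∧ K.map Prod.snd = ν}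

/-- The Wasserstein-1-distance, with values in `[0, ∞]`. The space is separable, so the product
σ-algebra on `X × X` is the Borel one and all Borel measures are separably supported. -/
def wassersteinDist {X : Type*} [MetricSpace X] [SecondCountableTopology X] [MeasurableSpace X]
    [BorelSpace X] (μ ν : Measure X) : ENNReal :=
  ⨅ K ∈ couplings μ ν, ∫⁻ p, edist p.1 p.2 ∂K

/-- The underlying set of Wasserstein-1-space over `X`: the Borel probability measures
at finite distance from some Dirac measure. -/
structure WassersteinSpace (X : Type*) [MetricSpace X] [SecondCountableTopology X]
    [MeasurableSpace X] [BorelSpace X] where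
  toMeasure : Measure X
  isProbabilityMeasure : IsProbabilityMeasure toMeasure
  exists_dist_lt_top : ∃ x : X, wassersteinDist toMeasure (Measure.dirac x) < ⊤

/-- The points of the unit sphere of Euclidean 3-space. It is a type of its own (not a subtype)
because it carries the geodesic metric and not the chordal one. -/
@[ext] structure RoundSphere where
  val : EuclideanSpace ℝ (Fin 3)
  norm_val : ‖val‖ = 1

namespace RoundSphere

/-- The Riemannian (great circle) distance of the unit sphere: the angle `arccos ⟪x, y⟫`. -/
instance : MetricSpace RoundSphere where
  dist x y := InnerProductGeometry.angle x.val y.val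
  dist_self x := InnerProductGeometry.angle_self (by
    intro h
    have := x.norm_val
    simp [h] at this)
  dist_comm x y := InnerProductGeometry.angle_comm _ _
  dist_triangle x y z := InnerProductGeometry.angle_le_angle_add_angle _ _ _
  eq_of_dist_eq_zero {x y} h := by
    apply RoundSphere.ext
    rw [← InnerProductGeometry.inner_eq_mul_norm_iff_angle_eq_zero, x.norm_val, y.norm_val,
      mul_one, inner_eq_one_iff_of_norm_eq_one x.norm_val y.norm_val] at h
    · exact h
    · exact fun h0 => by simpa [h0] using x.norm_val
    · exact fun h0 => by simpa [h0] using y.norm_val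

theorem dist_eq (x y : RoundSphere) :
    dist x y = InnerProductGeometry.angle x.val y.val := rfl

instance : MeasurableSpace RoundSphere := borel RoundSphere

instance : BorelSpace RoundSphere := ⟨rfl⟩

theorem continuous_mk : Continuous
    (fun x : Metric.sphere (0 : EuclideanSpace ℝ (Fin 3)) 1 =>
      (⟨x.1, mem_sphere_zero_iff_norm.1 x.2⟩ : RoundSphere)) := by
  rw [continuous_iff_continuousAt]
  intro x
  rw [ContinuousAt, tendsto_iff_dist_tendsto_zero]
  have h : Continuous (fun y : Metric.sphere (0 : EuclideanSpace ℝ (Fin 3)) 1 =>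
      InnerProductGeometry.angle y.1 x.1) := by
    unfold InnerProductGeometry.angle
    have h1 : ∀ y : Metric.sphere (0 : EuclideanSpace ℝ (Fin 3)) 1, ‖y.1‖ = 1 :=
      fun y => mem_sphere_zero_iff_norm.1 y.2
    simp only [h1]
    fun_prop
  have h2 := h.tendsto x
  rwa [InnerProductGeometry.angle_self (by
    intro h0
    have := mem_sphere_zero_iff_norm.1 x.2
    simp [h0] at this)] at h2

instance : SecondCountableTopology RoundSphere := by
  have hs : Function.Surjective (fun x : Metric.sphere (0 : EuclideanSpace ℝ (Fin 3)) 1 =>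
      (⟨x.1, mem_sphere_zero_iff_norm.1 x.2⟩ : RoundSphere)) :=
    fun y => ⟨⟨y.val, mem_sphere_zero_iff_norm.2 y.norm_val⟩, rfl⟩
  have : TopologicalSpace.SeparableSpace RoundSphere :=
    hs.denseRange.separableSpace continuous_mk
  exact UniformSpace.secondCountable_of_separable RoundSphere

end RoundSphere

/-- The closed hemisphere. It is geodesically convex, so the restricted metric of the sphere is its
intrinsic one. -/
def hemisphere : Set RoundSphere := {x | 0 ≤ x.val 2}

/-- The boundary circle of the hemisphere. It is a great circle, so the restricted metric of the
sphere is its arc length metric. -/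
def equator : Set RoundSphere := {x | x.val 2 = 0}

/-- The point `Q + t` of the circle: `Q` moved by the arc length `t` in the positive direction. -/
def equatorShift (Q : equator) (t : ℝ) : equator :=
  ⟨⟨!₂[Real.cos t * Q.1.val 0 - Real.sin t * Q.1.val 1,
      Real.sin t * Q.1.val 0 + Real.cos t * Q.1.val 1, 0], by
    have h := Q.1.norm_val
    have h2 : Q.1.val 2 = 0 := Q.2
    rw [EuclideanSpace.norm_eq, Real.sqrt_eq_one] at h ⊢
    simp only [Fin.sum_univ_three, Real.norm_eq_abs, sq_abs, h2] at h
    simp [Fin.sum_univ_three]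
    nlinarith [Real.sin_sq_add_cos_sq t]⟩, by simp [equator]⟩

/-- The second derivative at `Q`, with respect to arc length on the circle, of the function
`d_P = dist P`. -/
def distSecondDeriv (P : RoundSphere) (Q : equator) : ℝ :=
  iteratedDeriv 2 (fun t : ℝ => dist P (equatorShift Q t : RoundSphere)) 0

/-- The cosine `k_P` of the distance of `P` from the circle. -/
def cosDistEquator (P : RoundSphere) : ℝ := Real.cos (Metric.infDist P equator)

/-- The density `½ (d_P'')⁺ + (1 - k_P) / (2π)` on the circle. -/
def hemisphereDensity (P : RoundSphere) (Q : equator) : ℝ :=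
  1 / 2 * max (distSecondDeriv P Q) 0 + (1 - cosDistEquator P) / (2 * Real.pi)

end

/-! Fix `Q` on the circle and describe `P` by its distance `r` from `Q` and the cosine `c` of the
angle at `Q` between `QP` and the positive direction. By the spherical law of cosines, `d_P(Q + s) =
arccos X(s)` with `X(s) = cos r cos s + c sin r sin s`, a sinusoid of amplitude `k_P`. As `d_P''`
has the sign of `X`, its positive part integrates explicitly. The half circle after `Q` gets mass
`(k + c)/2 + (1 - k)/2 = (1 + c)/2`, which does not depend on `r` (`sideCdf_pi`); the total mass is
1; and the mean distance from `Q` is `r` (`integral_mul_sideDensity`), which settles distances to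
Dirac measures.

For two points of the open hemisphere, take `Q` on the great circle through both: they share `c` and
lie at distance `|r - r'|` (`exists_dirCos_eq`). Lower bound: `d(Q, ·)` is 1-Lipschitz with means
`r` and `r'`. Upper bound for `r ≤ r'`: the mass of the arc from `Q` to `Q + s` decreases in `r` for
`s ≤ π` and increases for `s ≥ π` (`sideCdf_antitoneOn`, `sideCdf_monotoneOn`). Hence the quantile
coupling moves all mass away from `Q` inside its own half circle, at cost exactly `r' - r`. -/

open Real intervalIntegral

/-! ### The law of cosines as a sinusoid -/

/-- The cosine of the side opposite to the angle with cosine `c` in a spherical triangle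
with adjacent sides `r` and `s`. -/
noncomputable def cosSide (r c s : ℝ) : ℝ := cos r * cos s + c * sin r * sin s

/-- The derivative of `cosSide r c s` with respect to `s`. -/
noncomputable def cosSideDeriv (r c s : ℝ) : ℝ := -(cos r * sin s) + c * sin r * cos s

/-- The maximum of `cosSide r c s` over all `s`. -/
noncomputable def cosSideMax (r c : ℝ) : ℝ := √(cos r ^ 2 + c ^ 2 * sin r ^ 2)

theorem hasDerivAt_cosSide (r c s : ℝ) : HasDerivAt (cosSide r c) (cosSideDeriv r c s) s := by
  have := ((hasDerivAt_cos s).const_mul (cos r)).add ((hasDerivAt_sin s).const_mul (c * sin r))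
  refine this.congr_deriv ?_
  simp only [cosSideDeriv]; ring

theorem hasDerivAt_cosSideDeriv (r c s : ℝ) :
    HasDerivAt (cosSideDeriv r c) (-cosSide r c s) s := by
  have := ((hasDerivAt_sin s).const_mul (cos r)).neg.add
    ((hasDerivAt_cos s).const_mul (c * sin r))
  refine this.congr_deriv ?_
  simp only [cosSide]; ring

theorem continuous_cosSide (r c : ℝ) : Continuous (cosSide r c) := by
  unfold cosSide; fun_prop

theorem cosSide_comm (r c s : ℝ) : cosSide r c s = cosSide s c r := by
  simp only [cosSide]; ring

theorem cosSideMax_sq (r c : ℝ) : cosSideMax r c ^ 2 = cos r ^ 2 + c ^ 2 * sin r ^ 2 := by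
  rw [cosSideMax, sq_sqrt (by positivity)]

theorem cosSideMax_nonneg (r c : ℝ) : 0 ≤ cosSideMax r c := sqrt_nonneg _

theorem one_sub_cosSideMax_sq (r c : ℝ) :
    1 - cosSideMax r c ^ 2 = (1 - c ^ 2) * sin r ^ 2 := by
  rw [cosSideMax_sq, cos_sq']; ring

theorem cosSide_sq_add_cosSideDeriv_sq (r c s : ℝ) :
    cosSide r c s ^ 2 + cosSideDeriv r c s ^ 2 = cosSideMax r c ^ 2 := by
  rw [cosSideMax_sq]; simp only [cosSide, cosSideDeriv]
  linear_combination (cos r ^ 2 + c ^ 2 * sin r ^ 2) * sin_sq_add_cos_sq s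

theorem cosSideMax_lt_one {r c : ℝ} (hr : r ∈ Set.Ioo 0 π) (hc : c ^ 2 < 1) :
    cosSideMax r c < 1 := by
  have h1 := one_sub_cosSideMax_sq r c
  have h2 : 0 < (1 - c ^ 2) * sin r ^ 2 :=
    mul_pos (by linarith) (pow_pos (sin_pos_of_mem_Ioo hr) 2)
  nlinarith [cosSideMax_nonneg r c]

theorem one_sub_cosSide_sq_pos {r c : ℝ} (hr : r ∈ Set.Ioo 0 π) (hc : c ^ 2 < 1) (s : ℝ) :
    0 < 1 - cosSide r c s ^ 2 := by
  have h1 := cosSide_sq_add_cosSideDeriv_sq r c s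
  have h2 := cosSideMax_lt_one hr hc
  nlinarith [cosSideMax_nonneg r c, sq_nonneg (cosSideDeriv r c s)]

theorem cosSideMax_neg (r c : ℝ) : cosSideMax r (-c) = cosSideMax r c := by
  simp [cosSideMax]

theorem cosSideMax_pi_sub (r c : ℝ) : cosSideMax (π - r) c = cosSideMax r c := by
  simp [cosSideMax]

theorem cosSide_pi_sub_pi_sub (r c s : ℝ) : cosSide (π - r) c (π - s) = cosSide r c s := by
  simp [cosSide]

theorem cosSide_neg_pi_sub (r c s : ℝ) : cosSide r (-c) (π - s) = -cosSide r c s := by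
  simp [cosSide]; ring

theorem cosSide_neg_neg (r c s : ℝ) : cosSide r (-c) (-s) = cosSide r c s := by
  simp [cosSide]

theorem cosSide_add_two_pi (r c s : ℝ) : cosSide r c (s + 2 * π) = cosSide r c s := by
  simp [cosSide]

/-- Solutions of `f'' = -f` are determined by two values. For `s ≤ t ≤ u ≤ s + π` the coefficients
are nonnegative, so a common sign at `s` and `u` passes to `t`. -/
theorem sin_sub_mul_cosSide (r c s t u : ℝ) :
    sin (u - s) * cosSide r c t = sin (u - t) * cosSide r c s + sin (t - s) * cosSide r c u := by
  simp only [cosSide, sin_sub]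
  ring

theorem cosSide_add (r c s t : ℝ) :
    cosSide r c (s + t) = cosSide r c s * cos t + cosSideDeriv r c s * sin t := by
  simp only [cosSide, cosSideDeriv, cos_add, sin_add]; ring

theorem cosSide_nonneg_of_mem_Icc {r c s t u : ℝ} (hs : 0 ≤ cosSide r c s)
    (hu : 0 ≤ cosSide r c u) (ht : t ∈ Set.Icc s u) (h : u - s < π) : 0 ≤ cosSide r c t := by
  obtain ⟨h1, h2⟩ := ht
  rcases (h1.trans h2).eq_or_lt with rfl | h3
  · rwa [le_antisymm h2 h1]
  have h4 := sin_pos_of_pos_of_lt_pi (sub_pos.2 h3) h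
  refine nonneg_of_mul_nonneg_right (a := sin (u - s)) ?_ h4
  rw [sin_sub_mul_cosSide]
  have h5 := sin_nonneg_of_nonneg_of_le_pi (sub_nonneg.2 h2) (by linarith)
  have h6 := sin_nonneg_of_nonneg_of_le_pi (sub_nonneg.2 h1) (by linarith)
  positivity

theorem cosSide_nonpos_of_mem_Icc {r c s t u : ℝ} (hs : cosSide r c s ≤ 0)
    (hu : cosSide r c u ≤ 0) (ht : t ∈ Set.Icc s u) (h : u - s < π) : cosSide r c t ≤ 0 := by
  obtain ⟨h1, h2⟩ := ht
  rcases (h1.trans h2).eq_or_lt with rfl | h3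
  · rwa [le_antisymm h2 h1]
  have h4 := sin_pos_of_pos_of_lt_pi (sub_pos.2 h3) h
  refine nonpos_of_mul_nonpos_right (a := sin (u - s)) ?_ h4
  rw [sin_sub_mul_cosSide]
  have h5 := sin_nonneg_of_nonneg_of_le_pi (sub_nonneg.2 h2) (by linarith)
  have h6 := sin_nonneg_of_nonneg_of_le_pi (sub_nonneg.2 h1) (by linarith)
  nlinarith

/-! ### Derivatives of the distance along the circle -/

/-- The derivative with respect to `s` of the side with cosine `cosSide r c s`. -/
noncomputable def sideDeriv (r c s : ℝ) : ℝ := -cosSideDeriv r c s / √(1 - cosSide r c s ^ 2)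

/-- The second derivative with respect to `s` of the side with cosine `cosSide r c s`. -/
noncomputable def sideDeriv2 (r c s : ℝ) : ℝ :=
  (1 - cosSideMax r c ^ 2) * cosSide r c s /
    ((1 - cosSide r c s ^ 2) * √(1 - cosSide r c s ^ 2))

theorem hasDerivAt_arccos_cosSide {r c : ℝ} (hr : r ∈ Set.Ioo 0 π) (hc : c ^ 2 < 1) (s : ℝ) :
    HasDerivAt (fun s => arccos (cosSide r c s)) (sideDeriv r c s) s := by
  have hD := one_sub_cosSide_sq_pos hr hc s
  have h1 : cosSide r c s ≠ -1 := by intro h; rw [h] at hD; norm_num at hD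
  have h2 : cosSide r c s ≠ 1 := by intro h; rw [h] at hD; norm_num at hD
  refine ((hasDerivAt_arccos h1 h2).comp s (hasDerivAt_cosSide r c s)).congr_deriv ?_
  simp only [sideDeriv]; ring

/-- Writing `X` for `cosSide` and `k` for its amplitude, the numerator is `X (1 - X² - X'²)`, and
`X² + X'² = k²`. -/
theorem hasDerivAt_sideDeriv {r c : ℝ} (hr : r ∈ Set.Ioo 0 π) (hc : c ^ 2 < 1) (s : ℝ) :
    HasDerivAt (sideDeriv r c) (sideDeriv2 r c s) s := by
  have hD := one_sub_cosSide_sq_pos hr hc s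
  have hw := sqrt_pos.2 hD
  have h1 := (((hasDerivAt_cosSide r c s).pow 2).const_sub 1).sqrt hD.ne'
  refine ((hasDerivAt_cosSideDeriv r c s).neg.div h1 hw.ne').congr_deriv ?_
  have h2 := cosSide_sq_add_cosSideDeriv_sq r c s
  have h3 := sq_sqrt hD.le
  simp only [Pi.neg_apply, Pi.pow_apply, neg_neg, sideDeriv2]
  set w := √(1 - cosSide r c s ^ 2)
  rw [← h3]
  field_simp
  rw [← h2, h3]
  ring

theorem continuous_sideDeriv2 {r c : ℝ} (hr : r ∈ Set.Ioo 0 π) (hc : c ^ 2 < 1) :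
    Continuous (sideDeriv2 r c) := by
  have h := continuous_cosSide r c
  unfold sideDeriv2
  refine Continuous.div (by fun_prop) (by fun_prop) fun s => ?_
  have hD := one_sub_cosSide_sq_pos hr hc s
  positivity

theorem sideDeriv2_nonneg {r c : ℝ} (hr : r ∈ Set.Ioo 0 π) (hc : c ^ 2 < 1) {s : ℝ}
    (h : 0 ≤ cosSide r c s) : 0 ≤ sideDeriv2 r c s := by
  have hD := one_sub_cosSide_sq_pos hr hc s
  have h1 := cosSideMax_lt_one hr hc
  have h2 : 0 ≤ 1 - cosSideMax r c ^ 2 := by nlinarith [cosSideMax_nonneg r c]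
  unfold sideDeriv2; positivity

theorem sideDeriv2_nonpos {r c : ℝ} (hr : r ∈ Set.Ioo 0 π) (hc : c ^ 2 < 1) {s : ℝ}
    (h : cosSide r c s ≤ 0) : sideDeriv2 r c s ≤ 0 := by
  have hD := one_sub_cosSide_sq_pos hr hc s
  have h1 := cosSideMax_lt_one hr hc
  have h2 : 0 ≤ 1 - cosSideMax r c ^ 2 := by nlinarith [cosSideMax_nonneg r c]
  exact div_nonpos_of_nonpos_of_nonneg (mul_nonpos_of_nonneg_of_nonpos h2 h) (by positivity)

theorem sideDeriv_zero {r : ℝ} (hr : r ∈ Set.Ioo 0 π) (c : ℝ) : sideDeriv r c 0 = -c := by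
  have h := sin_pos_of_mem_Ioo hr
  have h1 : √(1 - cos r ^ 2) = sin r := by
    rw [← sin_sq, sqrt_sq h.le]
  simp [sideDeriv, cosSide, cosSideDeriv, h1]
  field_simp

theorem sideDeriv_pi {r : ℝ} (hr : r ∈ Set.Ioo 0 π) (c : ℝ) : sideDeriv r c π = c := by
  have h := sin_pos_of_mem_Ioo hr
  have h1 : √(1 - cos r ^ 2) = sin r := by
    rw [← sin_sq, sqrt_sq h.le]
  simp [sideDeriv, cosSide, cosSideDeriv, h1]
  field_simp

theorem integral_sideDeriv2 {r c : ℝ} (hr : r ∈ Set.Ioo 0 π) (hc : c ^ 2 < 1) (s t : ℝ) :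
    ∫ u in s..t, sideDeriv2 r c u = sideDeriv r c t - sideDeriv r c s :=
  integral_eq_sub_of_hasDerivAt (fun u _ => hasDerivAt_sideDeriv hr hc u)
    ((continuous_sideDeriv2 hr hc).intervalIntegrable _ _)

theorem integral_posPart_sideDeriv2_of_nonneg {r c : ℝ} (hr : r ∈ Set.Ioo 0 π) (hc : c ^ 2 < 1)
    {s t : ℝ} (hst : s ≤ t) (h : ∀ u ∈ Set.Icc s t, 0 ≤ cosSide r c u) :
    ∫ u in s..t, max (sideDeriv2 r c u) 0 = sideDeriv r c t - sideDeriv r c s := by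
  rw [← integral_sideDeriv2 hr hc]
  refine integral_congr fun u hu => ?_
  rw [Set.uIcc_of_le hst] at hu
  exact max_eq_left (sideDeriv2_nonneg hr hc (h u hu))

theorem integral_posPart_sideDeriv2_of_nonpos {r c : ℝ} (hr : r ∈ Set.Ioo 0 π) (hc : c ^ 2 < 1)
    {s t : ℝ} (hst : s ≤ t) (h : ∀ u ∈ Set.Icc s t, cosSide r c u ≤ 0) :
    ∫ u in s..t, max (sideDeriv2 r c u) 0 = 0 := by
  trans ∫ _ in s..t, (0 : ℝ)
  swap
  · simp
  refine integral_congr fun u hu => ?_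
  rw [Set.uIcc_of_le hst] at hu
  exact max_eq_right (sideDeriv2_nonpos hr hc (h u hu))

theorem cosSide_zero (r c : ℝ) : cosSide r c 0 = cos r := by simp [cosSide]

theorem Ioc_half_pi_subset : Set.Ioc 0 (π / 2) ⊆ Set.Ioo 0 π :=
  fun _ h => ⟨h.1, by linarith [h.2, pi_pos]⟩

theorem integral_posPart_sideDeriv2_of_cosSide_nonneg {r c s : ℝ} (hr : r ∈ Set.Ioc 0 (π / 2))
    (hc : c ^ 2 < 1) (hs : 0 ≤ s) (hs' : s < π) (h : 0 ≤ cosSide r c s) :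
    ∫ u in (0 : ℝ)..s, max (sideDeriv2 r c u) 0 = sideDeriv r c s + c := by
  have hr' := Ioc_half_pi_subset hr
  have h0 : 0 ≤ cosSide r c 0 := by
    rw [cosSide_zero]; exact cos_nonneg_of_mem_Icc ⟨by linarith [hr.1, pi_pos], hr.2⟩
  rw [integral_posPart_sideDeriv2_of_nonneg hr' hc hs
    fun u hu => cosSide_nonneg_of_mem_Icc h0 h hu (by simpa using hs'), sideDeriv_zero hr']
  ring

/-- Only the stretch up to a zero `t` of `X` contributes. There `X' = -k`, so the derivative of the
distance has grown from `-c` to `k`. -/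
theorem integral_posPart_sideDeriv2_of_cosSide_nonpos {r c s : ℝ} (hr : r ∈ Set.Ioc 0 (π / 2))
    (hc : c ^ 2 < 1) (hs : 0 < s) (hs' : s < π) (h : cosSide r c s ≤ 0) :
    ∫ u in (0 : ℝ)..s, max (sideDeriv2 r c u) 0 = cosSideMax r c + c := by
  have hr' := Ioc_half_pi_subset hr
  have h0 : 0 ≤ cosSide r c 0 := by
    rw [cosSide_zero]; exact cos_nonneg_of_mem_Icc ⟨by linarith [hr.1, pi_pos], hr.2⟩
  obtain ⟨t, ht, htz⟩ := intermediate_value_Icc' hs.le (continuous_cosSide r c).continuousOn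
    ⟨h, h0⟩
  have hcont : Continuous fun u => max (sideDeriv2 r c u) 0 :=
    (continuous_sideDeriv2 hr' hc).max continuous_const
  rw [← integral_add_adjacent_intervals (b := t) (hcont.intervalIntegrable _ _)
    (hcont.intervalIntegrable _ _),
    integral_posPart_sideDeriv2_of_cosSide_nonneg hr hc ht.1 (by linarith [ht.2]) htz.ge,
    integral_posPart_sideDeriv2_of_nonpos hr' hc ht.2
      fun u hu => cosSide_nonpos_of_mem_Icc htz.le h hu (by linarith [ht.1])]
  -- `X` crosses downwards at `t`: expand `X(s) ≤ 0` around `t`, or `X(0) ≥ 0` when `t = s`.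
  have hY : cosSideDeriv r c t ≤ 0 := by
    rcases ht.2.eq_or_lt with h1 | h1
    · have h2 := cosSide_add r c t (-t)
      rw [add_neg_cancel, htz, sin_neg] at h2
      have h3 := sin_pos_of_pos_of_lt_pi (h1 ▸ hs) (h1 ▸ hs')
      nlinarith
    · have h2 := cosSide_add r c t (s - t)
      rw [add_sub_cancel, htz] at h2
      have h3 := sin_pos_of_pos_of_lt_pi (sub_pos.2 h1) (by linarith [ht.1])
      nlinarith
  have h4 := cosSide_sq_add_cosSideDeriv_sq r c t
  have h5 : -cosSideDeriv r c t = cosSideMax r c := by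
    refine (sq_eq_sq₀ (by linarith) (cosSideMax_nonneg r c)).1 ?_
    rw [← h4, htz]; ring
  rw [sideDeriv, htz, h5]
  simp

/-! ### Dependence on `r` -/

theorem hasDerivAt_sideDeriv_left {r c s : ℝ} (hD : 0 < 1 - cosSide r c s ^ 2) :
    HasDerivAt (fun r => sideDeriv r c s) (-((1 - c ^ 2) * sin r * sin s /
      ((1 - cosSide r c s ^ 2) * √(1 - cosSide r c s ^ 2)))) r := by
  have hw := sqrt_pos.2 hD
  have h0 : HasDerivAt (fun r => cosSide r c s) (cosSideDeriv s c r) r := by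
    have := hasDerivAt_cosSide s c r
    exact this.congr_of_eventuallyEq (.of_forall fun r => cosSide_comm r c s)
  have h0' : HasDerivAt (fun r => cosSideDeriv r c s) (sin r * sin s + c * cos r * cos s) r := by
    have := ((hasDerivAt_cos r).mul_const (sin s)).neg.add
      (((hasDerivAt_sin r).const_mul c).mul_const (cos s))
    exact this.congr_deriv (by ring)
  have h1 := ((h0.pow 2).const_sub 1).sqrt hD.ne'
  refine (h0'.neg.div h1 hw.ne').congr_deriv ?_
  have h3 := sq_sqrt hD.le
  have h4 : (sin r * sin s + c * cos r * cos s) * (1 - cosSide r c s ^ 2)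
      + cosSide r c s * cosSideDeriv s c r * cosSideDeriv r c s = (1 - c ^ 2) * sin r * sin s := by
    simp only [cosSide, cosSideDeriv]
    have hr := sin_sq r
    have hs := sin_sq s
    grind
  simp only [Pi.neg_apply, Pi.pow_apply]
  set w := √(1 - cosSide r c s ^ 2)
  rw [← h3] at h4 ⊢
  field_simp
  push_cast
  linear_combination -2 * h4

theorem hasDerivAt_cosSideMax {r c : ℝ} (h : cosSideMax r c ≠ 0) :
    HasDerivAt (fun r => cosSideMax r c)
      (-((1 - c ^ 2) * sin r * cos r / cosSideMax r c)) r := by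
  have h1 : cos r ^ 2 + c ^ 2 * sin r ^ 2 ≠ 0 := by
    intro h2; apply h; rw [cosSideMax, h2, sqrt_zero]
  have := (((hasDerivAt_cos r).pow 2).add (((hasDerivAt_sin r).pow 2).const_mul (c ^ 2))).sqrt h1
  refine this.congr_deriv ?_
  simp only [cosSideMax, Pi.add_apply, Pi.pow_apply] at h ⊢
  field_simp
  ring

theorem continuous_cosSideMax (c : ℝ) : Continuous fun r => cosSideMax r c := by
  unfold cosSideMax; fun_prop

theorem cosSideMax_antitoneOn {c : ℝ} (hc : c ^ 2 < 1) :
    AntitoneOn (fun r => cosSideMax r c) (Set.Icc 0 (π / 2)) := by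
  intro r hr r' hr' h
  have h1 := sin_le_sin_of_le_of_le_pi_div_two (by linarith [hr.1, pi_pos]) hr'.2 h
  have h2 := sin_nonneg_of_nonneg_of_le_pi hr.1 (by linarith [hr.2, pi_pos])
  have h3 := one_sub_cosSideMax_sq r c
  have h4 := one_sub_cosSideMax_sq r' c
  refine (sq_le_sq₀ (cosSideMax_nonneg _ _) (cosSideMax_nonneg _ _)).1 ?_
  have h5 : sin r ^ 2 ≤ sin r' ^ 2 := pow_le_pow_left₀ h2 h1 2
  nlinarith

/-- This is what makes the `r`-derivative of `sideCdf` nonpositive where `X ≥ 0`. For `s ≤ π/2` use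
Jordan's inequality and `cos r ≤ k`; beyond, `X ≥ 0` forces `cos r ≤ k sin s`, and `s ≤ π`. -/
theorem cos_mul_le_cosSideMax_mul_sin {r c s : ℝ} (hr : r ∈ Set.Ioc 0 (π / 2))
    (hs : s ∈ Set.Ioo 0 π) (h : 0 ≤ cosSide r c s) :
    cos r * s ≤ π * cosSideMax r c * sin s := by
  have hcr : 0 ≤ cos r := cos_nonneg_of_mem_Icc ⟨by linarith [hr.1, pi_pos], hr.2⟩
  have ha := cosSideMax_nonneg r c
  have ha2 := cosSideMax_sq r c
  have hss := sin_pos_of_mem_Ioo hs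
  rcases le_total s (π / 2) with h1 | h1
  · have h2 := mul_le_sin hs.1.le h1
    have h3 : cos r ≤ cosSideMax r c := by
      refine (sq_le_sq₀ hcr ha).1 ?_
      rw [ha2]; nlinarith [mul_nonneg (sq_nonneg c) (sq_nonneg (sin r))]
    have h4 : s ≤ π * sin s := by
      have : 2 / π * s = 2 * s / π := by ring
      rw [this, div_le_iff₀ pi_pos] at h2
      nlinarith [hs.1]
    calc cos r * s ≤ cosSideMax r c * (π * sin s) := mul_le_mul h3 h4 hs.1.le ha
      _ = _ := by ring
  · have h2 : cos s ≤ 0 := cos_nonpos_of_pi_div_two_le_of_le h1 (by linarith [hs.2, pi_pos])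
    have h3 : cos r * -cos s ≤ c * sin r * sin s := by
      simp only [cosSide] at h; linarith
    have h4 : (cos r * -cos s) ^ 2 ≤ (c * sin r * sin s) ^ 2 :=
      pow_le_pow_left₀ (mul_nonneg hcr (by linarith)) h3 2
    have h5 : cos r ≤ cosSideMax r c * sin s := by
      refine (sq_le_sq₀ hcr (by positivity)).1 ?_
      rw [mul_pow, ha2]
      nlinarith [sin_sq_add_cos_sq s]
    calc cos r * s ≤ (cosSideMax r c * sin s) * π :=
        mul_le_mul h5 hs.2.le hs.1.le (by positivity)
      _ = _ := by ring

/-! ### Density and distribution function -/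

/-- The density on the circle of the measure representing the point at distance `r` from the origin
of the circle in the direction with cosine `c`. -/
noncomputable def sideDensity (r c s : ℝ) : ℝ :=
  1 / 2 * max (sideDeriv2 r c s) 0 + (1 - cosSideMax r c) / (2 * π)

/-- The primitive of `sideDensity r c`. -/
noncomputable def sideCdf (r c s : ℝ) : ℝ := ∫ u in (0 : ℝ)..s, sideDensity r c u

theorem continuous_sideDensity {r c : ℝ} (hr : r ∈ Set.Ioo 0 π) (hc : c ^ 2 < 1) :
    Continuous (sideDensity r c) := by
  have := continuous_sideDeriv2 hr hc
  unfold sideDensity; fun_prop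

theorem le_sideDensity (r c s : ℝ) : (1 - cosSideMax r c) / (2 * π) ≤ sideDensity r c s := by
  have := le_max_right (sideDeriv2 r c s) 0
  unfold sideDensity; linarith

theorem sideDensity_pos {r c : ℝ} (hr : r ∈ Set.Ioo 0 π) (hc : c ^ 2 < 1) (s : ℝ) :
    0 < sideDensity r c s :=
  (div_pos (sub_pos.2 (cosSideMax_lt_one hr hc)) two_pi_pos).trans_le (le_sideDensity r c s)

theorem sideDensity_pi_sub_pi_sub (r c s : ℝ) :
    sideDensity (π - r) c (π - s) = sideDensity r c s := by
  simp only [sideDensity, sideDeriv2, cosSide_pi_sub_pi_sub, cosSideMax_pi_sub]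

theorem sideDensity_neg_neg (r c s : ℝ) : sideDensity r (-c) (-s) = sideDensity r c s := by
  simp only [sideDensity, sideDeriv2, cosSide_neg_neg, cosSideMax_neg]

theorem sideDensity_add_two_pi (r c s : ℝ) :
    sideDensity r c (s + 2 * π) = sideDensity r c s := by
  simp only [sideDensity, sideDeriv2, cosSide_add_two_pi]

theorem sideCdf_zero (r c : ℝ) : sideCdf r c 0 = 0 := by simp [sideCdf]

theorem sideCdf_eq {r c : ℝ} (hr : r ∈ Set.Ioo 0 π) (hc : c ^ 2 < 1) (s : ℝ) :
    sideCdf r c s = 1 / 2 * (∫ u in (0 : ℝ)..s, max (sideDeriv2 r c u) 0)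
      + (1 - cosSideMax r c) / (2 * π) * s := by
  have h := continuous_sideDeriv2 hr hc
  unfold sideCdf sideDensity
  rw [intervalIntegral.integral_add, intervalIntegral.integral_const_mul,
    intervalIntegral.integral_const]
  · simp; ring
  · exact Continuous.intervalIntegrable (by fun_prop) _ _
  · simp

theorem integral_posPart_sideDeriv2_pi {r c : ℝ} (hr : r ∈ Set.Ioo 0 π) (hc : c ^ 2 < 1) :
    ∫ u in (0 : ℝ)..π, max (sideDeriv2 r c u) 0 = cosSideMax r c + c := by
  wlog hr2 : r ≤ π / 2 generalizing r
  -- View `P` from the antipode of `Q`, with the orientation reversed: `r` becomes `π - r` and `c`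
  -- is unchanged.
  · have := this (r := π - r) ⟨by linarith [hr.2], by linarith [hr.1]⟩ (by linarith)
    rw [cosSideMax_pi_sub] at this
    rw [← this]
    have h1 := integral_comp_sub_left (a := 0) (b := π)
      (fun u => max (sideDeriv2 (π - r) c u) 0) π
    rw [sub_self, sub_zero] at h1
    rw [← h1]
    simp only [sideDeriv2, cosSide_pi_sub_pi_sub, cosSideMax_pi_sub]
  rcases hr2.eq_or_lt with rfl | hr3
  -- For `r = π/2`, `X = c sin u` keeps its sign on the whole half circle; otherwise it changes sign
  -- strictly inside.
  · have h1 : cosSideMax (π / 2) c = |c| := by simp [cosSideMax, sqrt_sq_eq_abs]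
    have h2 : ∀ u, cosSide (π / 2) c u = c * sin u := by simp [cosSide]
    rcases le_total 0 c with h3 | h3
    · rw [integral_posPart_sideDeriv2_of_nonneg hr hc pi_pos.le, sideDeriv_zero hr,
        sideDeriv_pi hr, h1, abs_of_nonneg h3, sub_neg_eq_add]
      intro u hu
      rw [h2]
      exact mul_nonneg h3 (sin_nonneg_of_mem_Icc hu)
    · rw [integral_posPart_sideDeriv2_of_nonpos hr hc pi_pos.le, h1, abs_of_nonpos h3,
        neg_add_cancel]
      intro u hu
      rw [h2]
      exact mul_nonpos_of_nonpos_of_nonneg h3 (sin_nonneg_of_mem_Icc hu)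
  · have h0 : 0 < cos r := cos_pos_of_mem_Ioo ⟨by linarith [hr.1, pi_pos], hr3⟩
    have hpi : cosSide r c π = -cos r := by simp [cosSide]
    obtain ⟨t, ht, htz⟩ := intermediate_value_Icc' pi_pos.le
      (continuous_cosSide r c).continuousOn (show (0 : ℝ) ∈ _ by
        rw [cosSide_zero, hpi]; constructor <;> linarith)
    have ht0 : 0 < t := by
      rcases ht.1.eq_or_lt with h | h
      · rw [← h, cosSide_zero] at htz; linarith
      · exact h
    have htpi : t < π := by
      rcases ht.2.eq_or_lt with h | h
      · rw [h, hpi] at htz; linarith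
      · exact h
    have hcont : Continuous fun u => max (sideDeriv2 r c u) 0 :=
      (continuous_sideDeriv2 hr hc).max continuous_const
    rw [← integral_add_adjacent_intervals (b := t) (hcont.intervalIntegrable _ _)
      (hcont.intervalIntegrable _ _),
      integral_posPart_sideDeriv2_of_cosSide_nonpos ⟨hr.1, hr2⟩ hc ht0 htpi htz.le,
      integral_posPart_sideDeriv2_of_nonpos hr hc ht.2, add_zero]
    exact fun u hu => cosSide_nonpos_of_mem_Icc htz.le (by rw [hpi]; linarith) hu (by linarith)

theorem sideCdf_pi {r c : ℝ} (hr : r ∈ Set.Ioo 0 π) (hc : c ^ 2 < 1) :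
    sideCdf r c π = (1 + c) / 2 := by
  rw [sideCdf_eq hr hc, integral_posPart_sideDeriv2_pi hr hc]
  field_simp
  ring

/-- Reversing the orientation of the circle replaces `c` by `-c`. -/
theorem sideCdf_two_pi_sub {r c : ℝ} (hr : r ∈ Set.Ioo 0 π) (hc : c ^ 2 < 1) (s : ℝ) :
    sideCdf r c (2 * π - s) = sideCdf r c (2 * π) - sideCdf r (-c) s := by
  have hi := fun a b => (continuous_sideDensity hr hc).intervalIntegrable (μ := volume) a b
  have h1 := integral_comp_sub_left (a := 0) (b := s) (sideDensity r c) (2 * π)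
  have h2 := integral_add_adjacent_intervals (hi 0 (2 * π - s)) (hi _ (2 * π))
  have h3 : ∀ u, sideDensity r c (2 * π - u) = sideDensity r (-c) u := fun u => by
    rw [← sideDensity_neg_neg r (-c) u, neg_neg, ← sideDensity_add_two_pi r c (-u)]
    ring_nf
  simp only [h3, sub_zero] at h1
  simp only [sideCdf]
  linarith

theorem sideCdf_two_pi {r c : ℝ} (hr : r ∈ Set.Ioo 0 π) (hc : c ^ 2 < 1) :
    sideCdf r c (2 * π) = 1 := by
  have h := sideCdf_two_pi_sub hr hc π
  have h1 : 2 * π - π = π := by ring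
  rw [h1, sideCdf_pi hr hc, sideCdf_pi hr (by simpa using hc)] at h
  linarith

theorem sideCdf_pi_sub_pi_sub {r c : ℝ} (hr : r ∈ Set.Ioo 0 π) (hc : c ^ 2 < 1) (s : ℝ) :
    sideCdf (π - r) c (π - s) = (1 + c) / 2 - sideCdf r c s := by
  have hr' : π - r ∈ Set.Ioo 0 π := ⟨by linarith [hr.2], by linarith [hr.1]⟩
  have hi := fun a b => (continuous_sideDensity hr' hc).intervalIntegrable (μ := volume) a b
  have h1 := integral_comp_sub_left (a := 0) (b := s) (sideDensity (π - r) c) π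
  have h2 := integral_add_adjacent_intervals (hi 0 (π - s)) (hi _ π)
  have h3 := sideCdf_pi hr' hc
  simp only [sideDensity_pi_sub_pi_sub, sub_zero] at h1
  simp only [sideCdf] at h3 ⊢
  linarith

/-! ### Monotonicity of the distribution function in `r` -/

theorem sideCdf_le_of_cosSide_nonneg {r r' c s : ℝ} (hr : r ∈ Set.Ioc 0 (π / 2))
    (hr' : r' ∈ Set.Ioc 0 (π / 2)) (hle : r ≤ r') (hc : c ^ 2 < 1) (hs : s ∈ Set.Ioo 0 π)
    (h : 0 ≤ cosSide r c s) (h' : 0 ≤ cosSide r' c s) : sideCdf r' c s ≤ sideCdf r c s := by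
  rw [sideCdf_eq (Ioc_half_pi_subset hr) hc, sideCdf_eq (Ioc_half_pi_subset hr') hc,
    integral_posPart_sideDeriv2_of_cosSide_nonneg hr hc hs.1.le hs.2 h,
    integral_posPart_sideDeriv2_of_cosSide_nonneg hr' hc hs.1.le hs.2 h']
  -- `X` is a sinusoid in `r` as well, so it stays nonnegative between `r` and `r'`.
  have key : ∀ ρ ∈ Set.Icc r r', ρ ∈ Set.Ioc 0 (π / 2) ∧ 0 ≤ cosSide ρ c s := by
    intro ρ hρ
    refine ⟨⟨hr.1.trans_le hρ.1, hρ.2.trans hr'.2⟩, ?_⟩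
    rw [cosSide_comm] at h h' ⊢
    exact cosSide_nonneg_of_mem_Icc h h' hρ (by linarith [hr.1, hr'.2, pi_pos])
  refine antitoneOn_of_deriv_nonpos (D := Set.Icc r r')
    (f := fun ρ => 1 / 2 * (sideDeriv ρ c s + c) + (1 - cosSideMax ρ c) / (2 * π) * s)
    (convex_Icc _ _) ?_ ?_ ?_ (Set.left_mem_Icc.2 hle) (Set.right_mem_Icc.2 hle) hle
  · have h1 : ContinuousOn (fun ρ => sideDeriv ρ c s) (Set.Icc r r') := fun ρ hρ =>
      (hasDerivAt_sideDeriv_left (one_sub_cosSide_sq_pos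
        (Ioc_half_pi_subset (key ρ hρ).1) hc s)).continuousAt.continuousWithinAt
    have h2 := (continuous_cosSideMax c).continuousOn (s := Set.Icc r r')
    fun_prop
  all_goals
    intro ρ hρ
    rw [interior_Icc] at hρ
    obtain ⟨h1, h2⟩ := key ρ (Set.Ioo_subset_Icc_self hρ)
    have h3 := Ioc_half_pi_subset h1
    -- The amplitude is differentiable in `ρ` only where it is nonzero; it can vanish at `π/2`,
    -- which is not an interior point.
    have hcos : 0 < cos ρ := cos_pos_of_mem_Ioo ⟨by linarith [h1.1, pi_pos], hρ.2.trans_le hr'.2⟩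
    have ha : 0 < cosSideMax ρ c :=
      sqrt_pos.2 (by positivity)
    have hD := one_sub_cosSide_sq_pos h3 hc s
    have hder := (((hasDerivAt_sideDeriv_left hD).add_const c).const_mul (1 / 2)).add
      ((((hasDerivAt_cosSideMax ha.ne').const_sub 1).div_const (2 * π)).mul_const s)
  · exact hder.differentiableAt.differentiableWithinAt
  · refine hder.deriv.trans_le ?_
    have h4 := cos_mul_le_cosSideMax_mul_sin h1 hs h2
    have hsr := sin_pos_of_mem_Ioo h3
    have hss := sin_pos_of_mem_Ioo hs
    -- Bounding this denominator by 1 reduces the claim to `cos_mul_le_cosSideMax_mul_sin`.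
    have h5 : (1 - cosSide ρ c s ^ 2) * √(1 - cosSide ρ c s ^ 2) ≤ 1 := by
      have h6 : 1 - cosSide ρ c s ^ 2 ≤ 1 := by nlinarith [sq_nonneg (cosSide ρ c s)]
      have h7 : √(1 - cosSide ρ c s ^ 2) ≤ 1 := by exact sqrt_le_one.2 h6
      exact mul_le_one₀ h6 (sqrt_nonneg _) h7
    have h6 : 0 < (1 - cosSide ρ c s ^ 2) * √(1 - cosSide ρ c s ^ 2) := by positivity
    set E := (1 - cosSide ρ c s ^ 2) * √(1 - cosSide ρ c s ^ 2)
    have hc' : 0 < 1 - c ^ 2 := by linarith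
    have h8 : (1 - c ^ 2) * sin ρ * cos ρ / cosSideMax ρ c / (2 * π) * s
        ≤ 1 / 2 * ((1 - c ^ 2) * sin ρ * sin s) := by
      rw [div_div, div_mul_eq_mul_div, div_le_iff₀ (by positivity)]
      have := mul_le_mul_of_nonneg_left h4 (show 0 ≤ (1 - c ^ 2) * sin ρ by positivity)
      nlinarith
    have h9 : (1 - c ^ 2) * sin ρ * sin s ≤ (1 - c ^ 2) * sin ρ * sin s / E := by
      rw [le_div_iff₀ h6]
      exact mul_le_of_le_one_right (by positivity) h5
    rw [neg_neg]
    linarith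

/-- Here the mass is `(k + c)/2 + (1 - k) s/(2π)`. The coefficient of `k` is nonnegative because `s
≤ π`, and `k` decreases in `r`. -/
theorem sideCdf_le_of_cosSide_nonpos {r r' c s : ℝ} (hr : r ∈ Set.Ioc 0 (π / 2))
    (hr' : r' ∈ Set.Ioc 0 (π / 2)) (hle : r ≤ r') (hc : c ^ 2 < 1) (hs : s ∈ Set.Ioo 0 π)
    (h : cosSide r c s ≤ 0) (h' : cosSide r' c s ≤ 0) : sideCdf r' c s ≤ sideCdf r c s := by
  rw [sideCdf_eq (Ioc_half_pi_subset hr) hc, sideCdf_eq (Ioc_half_pi_subset hr') hc,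
    integral_posPart_sideDeriv2_of_cosSide_nonpos hr hc hs.1 hs.2 h,
    integral_posPart_sideDeriv2_of_cosSide_nonpos hr' hc hs.1 hs.2 h']
  have h1 := cosSideMax_antitoneOn hc (Set.Ioc_subset_Icc_self hr)
    (Set.Ioc_subset_Icc_self hr') hle
  have h2 : s / (2 * π) ≤ 1 / 2 := by
    rw [div_le_iff₀ two_pi_pos]; linarith [hs.2]
  have h3 : ∀ a : ℝ, (1 - a) / (2 * π) * s = (1 - a) * (s / (2 * π)) := fun a => by ring
  simp only [h3] at h1 ⊢
  nlinarith

/-- If `X` changes sign between `r` and `r'`, pass through a zero `ρ`, where both preceding lemmas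
apply. -/
theorem sideCdf_antitoneOn_Ioc {c s : ℝ} (hc : c ^ 2 < 1) (hs : s ∈ Set.Ioo 0 π) :
    AntitoneOn (fun r => sideCdf r c s) (Set.Ioc 0 (π / 2)) := by
  intro r hr r' hr' hle
  have hcont : ContinuousOn (fun r => cosSide r c s) (Set.Icc r r') := by
    simp only [cosSide_comm _ c s]; exact (continuous_cosSide s c).continuousOn
  have hmem : ∀ ρ ∈ Set.Icc r r', ρ ∈ Set.Ioc 0 (π / 2) := fun ρ hρ =>
    ⟨hr.1.trans_le hρ.1, hρ.2.trans hr'.2⟩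
  rcases le_total 0 (cosSide r c s) with h | h <;> rcases le_total 0 (cosSide r' c s) with h' | h'
  · exact sideCdf_le_of_cosSide_nonneg hr hr' hle hc hs h h'
  · obtain ⟨ρ, hρ, hz⟩ := intermediate_value_Icc' hle hcont ⟨h', h⟩
    exact (sideCdf_le_of_cosSide_nonpos (hmem ρ hρ) hr' hρ.2 hc hs hz.le h').trans
      (sideCdf_le_of_cosSide_nonneg hr (hmem ρ hρ) hρ.1 hc hs h hz.ge)
  · obtain ⟨ρ, hρ, hz⟩ := intermediate_value_Icc hle hcont ⟨h, h'⟩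
    exact (sideCdf_le_of_cosSide_nonneg (hmem ρ hρ) hr' hρ.2 hc hs hz.ge h').trans
      (sideCdf_le_of_cosSide_nonpos hr (hmem ρ hρ) hρ.1 hc hs h hz.le)
  · exact sideCdf_le_of_cosSide_nonpos hr hr' hle hc hs h h'

/-- The range `r ≥ π/2` reduces to `r ≤ π/2` by viewing `P` from the antipode of `Q`; the two ranges
are glued at `π/2`. -/
theorem sideCdf_antitoneOn {c s : ℝ} (hc : c ^ 2 < 1) (hs : s ∈ Set.Icc 0 π) :
    AntitoneOn (fun r => sideCdf r c s) (Set.Ioo 0 π) := by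
  intro r hr r' hr' hle
  rcases hs.1.eq_or_lt with rfl | hs0
  · simp [sideCdf_zero]
  rcases hs.2.eq_or_lt with rfl | hs1
  · simp [sideCdf_pi hr hc, sideCdf_pi hr' hc]
  have h1 : ∀ r ∈ Set.Ico (π / 2) π, ∀ r' ∈ Set.Ico (π / 2) π, r ≤ r' →
      sideCdf r' c s ≤ sideCdf r c s := by
    intro r hr r' hr' hle
    have := sideCdf_antitoneOn_Ioc (s := π - s) hc ⟨by linarith, by linarith⟩
      (show π - r' ∈ _ from ⟨by linarith [hr'.2], by linarith [hr'.1]⟩)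
      (show π - r ∈ _ from ⟨by linarith [hr.2], by linarith [hr.1]⟩) (by linarith)
    simp only at this
    rw [sideCdf_pi_sub_pi_sub ⟨by linarith [hr.1, pi_pos], hr.2⟩ hc,
      sideCdf_pi_sub_pi_sub ⟨by linarith [hr'.1, pi_pos], hr'.2⟩ hc] at this
    linarith
  have hm : π / 2 ∈ Set.Ioc 0 (π / 2) := ⟨by positivity, le_rfl⟩
  have hm' : π / 2 ∈ Set.Ico (π / 2) π := ⟨le_rfl, by linarith [pi_pos]⟩
  rcases le_total r (π / 2) with h | h <;> rcases le_total r' (π / 2) with h' | h'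
  · exact sideCdf_antitoneOn_Ioc hc ⟨hs0, hs1⟩ ⟨hr.1, h⟩ ⟨hr'.1, h'⟩ hle
  · exact (h1 _ hm' _ ⟨h', hr'.2⟩ h').trans
      (sideCdf_antitoneOn_Ioc hc ⟨hs0, hs1⟩ ⟨hr.1, h⟩ hm h)
  · rw [show r = r' by linarith]
  · exact h1 _ ⟨h, hr.2⟩ _ ⟨h', hr'.2⟩ hle

theorem sideCdf_monotoneOn {c s : ℝ} (hc : c ^ 2 < 1) (hs : s ∈ Set.Icc π (2 * π)) :
    MonotoneOn (fun r => sideCdf r c s) (Set.Ioo 0 π) := by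
  intro r hr r' hr' hle
  have h := sideCdf_antitoneOn (c := -c) (s := 2 * π - s) (by simpa using hc)
    ⟨by linarith [hs.2], by linarith [hs.1]⟩ hr hr' hle
  have h1 := sideCdf_two_pi_sub hr hc (2 * π - s)
  have h2 := sideCdf_two_pi_sub hr' hc (2 * π - s)
  rw [sub_sub_cancel, sideCdf_two_pi] at h1 h2 <;> try assumption
  simp only at h ⊢
  linarith

/-- The mean distance from the origin of the circle. -/
theorem integral_mul_sideDensity {r c : ℝ} (hr : r ∈ Set.Ioo 0 π) (hc : c ^ 2 < 1) :
    (∫ s in (0 : ℝ)..π, s * sideDensity r c s) + ∫ s in (0 : ℝ)..π, s * sideDensity r (-c) s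
      = r := by
  have hc2 := continuous_sideDeriv2 hr hc
  have h1 : ∫ s in (0 : ℝ)..π, s * sideDensity r (-c) s =
      ∫ s in (0 : ℝ)..π, (π - s) * sideDensity r (-c) (π - s) := by
    rw [integral_comp_sub_left (fun s => s * sideDensity r (-c) s), sub_self, sub_zero]
  -- Antipodal points satisfy `d(P, -x) = π - d(P, x)`, so `d''` changes sign there. Pairing them
  -- leaves a single positive part, whose integral is known.
  have h2 : ∀ s, s * sideDensity r c s + (π - s) * sideDensity r (-c) (π - s) =
      1 / 2 * (s * sideDeriv2 r c s) + π / 2 * max (sideDeriv2 r c s) 0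
        - π / 2 * sideDeriv2 r c s + (1 - cosSideMax r c) / 2 := by
    intro s
    have : sideDeriv2 r (-c) (π - s) = -sideDeriv2 r c s := by
      simp only [sideDeriv2, cosSide_neg_pi_sub, cosSideMax_neg, neg_sq]; ring
    have h3 : max (-sideDeriv2 r c s) 0 = max (sideDeriv2 r c s) 0 - sideDeriv2 r c s := by
      rcases le_total 0 (sideDeriv2 r c s) with h | h
      · rw [max_eq_left h, max_eq_right (by linarith), sub_self]
      · rw [max_eq_right h, max_eq_left (by linarith), zero_sub]
    simp only [sideDensity, this, h3, cosSideMax_neg]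
    field_simp
    ring
  -- Integration by parts: `s d' - d` is a primitive of `s d''`.
  have hpart : ∫ s in (0 : ℝ)..π, s * sideDeriv2 r c s = π * c - π + 2 * r := by
    have hA := integral_eq_sub_of_hasDerivAt (a := 0) (b := π)
      (f := fun s => s * sideDeriv r c s - arccos (cosSide r c s))
      (f' := fun s => s * sideDeriv2 r c s) (fun s _ => by
        refine (((hasDerivAt_id s).mul (hasDerivAt_sideDeriv hr hc s)).sub
          (hasDerivAt_arccos_cosSide hr hc s)).congr_deriv ?_
        simp) (Continuous.intervalIntegrable (by fun_prop) _ _)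
    rw [hA]
    have h3 : cosSide r c π = -cos r := by simp [cosSide]
    rw [sideDeriv_pi hr, h3, cosSide_zero, arccos_neg, arccos_cos hr.1.le hr.2.le]
    ring
  have hd := continuous_sideDensity hr hc
  have hd' := continuous_sideDensity (c := -c) hr (by simpa using hc)
  rw [h1, ← intervalIntegral.integral_add (Continuous.intervalIntegrable (by fun_prop) _ _)
    (Continuous.intervalIntegrable (by fun_prop) _ _)]
  simp only [h2]
  rw [intervalIntegral.integral_add (Continuous.intervalIntegrable (by fun_prop) _ _)
    (Continuous.intervalIntegrable (by fun_prop) _ _),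
    intervalIntegral.integral_sub (Continuous.intervalIntegrable (by fun_prop) _ _)
    (Continuous.intervalIntegrable (by fun_prop) _ _),
    intervalIntegral.integral_add (Continuous.intervalIntegrable (by fun_prop) _ _)
    (Continuous.intervalIntegrable (by fun_prop) _ _)]
  simp only [intervalIntegral.integral_const_mul]
  rw [hpart, integral_posPart_sideDeriv2_pi hr hc, integral_sideDeriv2 hr hc, sideDeriv_pi hr,
    sideDeriv_zero hr, intervalIntegral.integral_const]
  simp
  ring

/-! ### Coordinates on the sphere and arc length on the equator -/

namespace RoundSphere

theorem inner_val (x y : RoundSphere) : inner ℝ x.val y.val =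
    x.val 0 * y.val 0 + x.val 1 * y.val 1 + x.val 2 * y.val 2 := by
  simp [PiLp.inner_apply, Fin.sum_univ_three]
  ring

theorem sum_sq (x : RoundSphere) : x.val 0 ^ 2 + x.val 1 ^ 2 + x.val 2 ^ 2 = 1 := by
  have h := x.norm_val
  rw [EuclideanSpace.norm_eq, Real.sqrt_eq_one] at h
  simpa [Fin.sum_univ_three] using h

theorem dist_eq_arccos (x y : RoundSphere) : dist x y = arccos (inner ℝ x.val y.val) := by
  rw [dist_eq, InnerProductGeometry.angle, x.norm_val, y.norm_val, mul_one, div_one]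

theorem abs_inner_val_le (x y : RoundSphere) : |inner ℝ x.val y.val| ≤ 1 := by
  simpa [x.norm_val, y.norm_val] using abs_real_inner_le_norm x.val y.val

theorem cos_dist (x y : RoundSphere) : cos (dist x y) = inner ℝ x.val y.val := by
  have h := abs_le.1 (abs_inner_val_le x y)
  rw [dist_eq_arccos, cos_arccos h.1 h.2]

theorem dist_mem_Icc (x y : RoundSphere) : dist x y ∈ Set.Icc 0 π := by
  rw [dist_eq_arccos]; exact ⟨arccos_nonneg _, arccos_le_pi _⟩

theorem inner_equatorShift (P : RoundSphere) (Q : equator) (t : ℝ) :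
    inner ℝ P.val (equatorShift Q t).1.val =
      cos t * inner ℝ P.val Q.1.val + sin t * inner ℝ P.val (equatorShift Q (π / 2)).1.val := by
  have h : Q.1.val 2 = 0 := Q.2
  simp only [inner_val, h]
  simp [equatorShift]
  ring

/-- `Q`, `Q + π/2` and the pole form an orthonormal basis. -/
theorem inner_val_eq_frame (P P' : RoundSphere) (Q : equator) : inner ℝ P.val P'.val =
    inner ℝ P.val Q.1.val * inner ℝ P'.val Q.1.val +
    inner ℝ P.val (equatorShift Q (π / 2)).1.val * inner ℝ P'.val (equatorShift Q (π / 2)).1.val +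
    P.val 2 * P'.val 2 := by
  have h : Q.1.val 2 = 0 := Q.2
  have h1 := Q.1.sum_sq
  simp only [inner_val, h]
  simp [equatorShift]
  rw [h] at h1
  linear_combination -(P.val 0 * P'.val 0 + P.val 1 * P'.val 1) * h1

end RoundSphere

open RoundSphere

theorem equatorShift_zero (Q : equator) : equatorShift Q 0 = Q := by
  have h : Q.1.val 2 = 0 := Q.2
  ext i
  fin_cases i <;> simp [equatorShift, h]

theorem equatorShift_equatorShift (Q : equator) (s t : ℝ) :
    equatorShift (equatorShift Q s) t = equatorShift Q (s + t) := by
  ext i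
  fin_cases i <;> simp [equatorShift, cos_add, sin_add] <;> ring

theorem inner_equatorShift_equatorShift (Q : equator) (s t : ℝ) :
    inner ℝ (equatorShift Q s).1.val (equatorShift Q t).1.val = cos (s - t) := by
  have h : Q.1.val 2 = 0 := Q.2
  have h1 := Q.1.sum_sq
  rw [h] at h1
  rw [inner_val, cos_sub]
  simp [equatorShift]
  linear_combination (cos s * cos t + sin s * sin t) * h1

theorem dist_equatorShift_equatorShift (Q : equator) {s t : ℝ} (h : |s - t| ≤ π) :
    dist (equatorShift Q s) (equatorShift Q t) = |s - t| := by
  rw [Subtype.dist_eq, dist_eq_arccos, inner_equatorShift_equatorShift, ← cos_abs,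
    arccos_cos (abs_nonneg _) h]

theorem dist_equatorShift_of_le_pi (Q : equator) {s : ℝ} (h0 : 0 ≤ s) (h : s ≤ π) :
    dist Q (equatorShift Q s) = s := by
  have h1 : |0 - s| = s := by rw [zero_sub, abs_neg, abs_of_nonneg h0]
  have := dist_equatorShift_equatorShift Q (h1.trans_le h)
  rwa [equatorShift_zero, h1] at this

theorem equatorShift_sub_two_pi (Q : equator) (s : ℝ) :
    equatorShift Q (s - 2 * π) = equatorShift Q s := by
  simp [equatorShift]

theorem dist_equatorShift_of_pi_le (Q : equator) {s : ℝ} (h0 : π ≤ s) (h : s ≤ 2 * π) :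
    dist Q (equatorShift Q s) = 2 * π - s := by
  have h1 : |0 - (s - 2 * π)| = 2 * π - s := by
    rw [zero_sub, neg_sub, abs_of_nonneg (by linarith)]
  have := dist_equatorShift_equatorShift Q (h1.trans_le (by linarith))
  rwa [equatorShift_zero, h1, equatorShift_sub_two_pi] at this

theorem dist_equatorShift_equatorShift_le (Q : equator) (s t : ℝ) :
    dist (equatorShift Q s) (equatorShift Q t) ≤ |s - t| := by
  rcases le_total |s - t| π with h | h
  · exact (dist_equatorShift_equatorShift Q h).le
  · exact (dist_mem_Icc _ _).2.trans h

theorem continuous_equatorShift (Q : equator) : Continuous (equatorShift Q) := by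
  refine (LipschitzWith.of_dist_le_mul (K := 1) fun s t => ?_).continuous
  rw [NNReal.coe_one, one_mul, Real.dist_eq]
  exact dist_equatorShift_equatorShift_le Q s t

theorem exists_mem_Ioc_cos_sin {x y : ℝ} (h : x ^ 2 + y ^ 2 = 1) :
    ∃ t ∈ Set.Ioc 0 (2 * π), cos t = x ∧ sin t = y := by
  have hz : ‖(⟨x, y⟩ : ℂ)‖ = 1 := by
    rw [Complex.norm_eq_sqrt_sq_add_sq, h, sqrt_one]
  have hz0 : (⟨x, y⟩ : ℂ) ≠ 0 := by
    intro h0; rw [h0, norm_zero] at hz; norm_num at hz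
  refine ⟨toIocMod two_pi_pos 0 (Complex.arg ⟨x, y⟩), ?_, ?_, ?_⟩
  · simpa using toIocMod_mem_Ioc two_pi_pos 0 (Complex.arg ⟨x, y⟩)
  · rw [toIocMod, zsmul_eq_mul, cos_sub_int_mul_two_pi, Complex.cos_arg hz0, hz, div_one]
  · rw [toIocMod, zsmul_eq_mul, sin_sub_int_mul_two_pi, Complex.sin_arg, hz, div_one]

theorem exists_equatorShift_eq (Q Q' : equator) :
    ∃ t ∈ Set.Ioc 0 (2 * π), equatorShift Q t = Q' := by
  have h : Q.1.val 2 = 0 := Q.2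
  have h' : Q'.1.val 2 = 0 := Q'.2
  have h1 := Q.1.sum_sq
  have h1' := Q'.1.sum_sq
  rw [h] at h1
  rw [h'] at h1'
  obtain ⟨t, ht, hc, hs⟩ := exists_mem_Ioc_cos_sin
    (x := Q.1.val 0 * Q'.1.val 0 + Q.1.val 1 * Q'.1.val 1)
    (y := Q.1.val 0 * Q'.1.val 1 - Q.1.val 1 * Q'.1.val 0) (by
      linear_combination (Q'.1.val 0 ^ 2 + Q'.1.val 1 ^ 2) * h1 + h1')
  refine ⟨t, ht, ?_⟩
  ext i
  fin_cases i
  · simp [equatorShift, hc, hs]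
    linear_combination Q'.1.val 0 * h1
  · simp [equatorShift, hc, hs]
    linear_combination Q'.1.val 1 * h1
  · simp [equatorShift, h']

theorem equatorShift_injOn (Q : equator) : Set.InjOn (equatorShift Q) (Set.Ioc 0 (2 * π)) := by
  intro s hs t ht h
  have h1 := inner_equatorShift_equatorShift Q s t
  rw [h, inner_equatorShift_equatorShift, sub_self, cos_zero, eq_comm,
    cos_eq_one_iff_of_lt_of_lt (by linarith [hs.1, ht.2]) (by linarith [hs.2, ht.1])] at h1
  linarith

/-- Arcs of length at most `π` are isometric to intervals, hence the bound on `s`; the full circle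
is then cut into two such arcs. -/
theorem hausdorffMeasure_equatorShift_image (Q : equator) (b : ℝ) {s : Set ℝ}
    (hs : s ⊆ Set.Icc b (b + π)) :
    (Measure.hausdorffMeasure 1 : Measure equator) (equatorShift Q '' s) = volume s := by
  have h1 : Isometry (fun x : Set.Icc b (b + π) => equatorShift Q x) := by
    refine Isometry.of_dist_eq fun x y => ?_
    rw [dist_equatorShift_equatorShift, Subtype.dist_eq, Real.dist_eq]
    rw [abs_le]
    constructor <;> linarith [x.2.1, x.2.2, y.2.1, y.2.2]
  have h2 := h1.hausdorffMeasure_image (d := 1) (Or.inl zero_le_one) (Subtype.val ⁻¹' s)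
  have h3 := (isometry_subtype_coe (s := Set.Icc b (b + π))).hausdorffMeasure_image (d := 1)
    (Or.inl zero_le_one) (Subtype.val ⁻¹' s)
  rw [Subtype.image_preimage_coe, Set.inter_eq_right.2 hs, hausdorffMeasure_real] at h3
  rw [h3, ← h2]
  congr 1
  rw [show (fun x : Set.Icc b (b + π) => equatorShift Q x) = equatorShift Q ∘ Subtype.val from rfl,
    Set.image_comp, Subtype.image_preimage_coe, Set.inter_eq_right.2 hs]

theorem hausdorffMeasure_equator_eq_map (Q : equator) :
    (Measure.hausdorffMeasure 1 : Measure equator) =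
      (volume.restrict (Set.Ioc 0 (2 * π))).map (equatorShift Q) := by
  have hpi := pi_pos
  have hγ := continuous_equatorShift Q
  have hun : Set.Ioc 0 π ∪ Set.Ioc π (2 * π) = Set.Ioc 0 (2 * π) :=
    Set.Ioc_union_Ioc_eq_Ioc hpi.le (by linarith)
  have hdisj : Disjoint (Set.Ioc 0 π) (Set.Ioc π (2 * π)) :=
    Set.Ioc_disjoint_Ioc_of_le le_rfl
  have himage : equatorShift Q '' Set.Ioc 0 (2 * π) = Set.univ :=
    Set.eq_univ_of_forall fun Q' => exists_equatorShift_eq Q Q'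
  have hmeas : MeasurableSet (equatorShift Q '' Set.Ioc 0 π) :=
    measurableSet_Ioc.image_of_continuousOn_injOn hγ.continuousOn
      ((equatorShift_injOn Q).mono (Set.Ioc_subset_Ioc_right (by linarith)))
  have hcompl : (equatorShift Q '' Set.Ioc 0 π)ᶜ = equatorShift Q '' Set.Ioc π (2 * π) := by
    refine IsCompl.compl_eq ⟨?_, ?_⟩
    · rw [Set.disjoint_left]
      rintro _ ⟨s, hs, rfl⟩ ⟨t, ht, hst⟩
      have := equatorShift_injOn Q (hun ▸ Or.inr ht) (hun ▸ Or.inl hs) hst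
      exact Set.disjoint_left.1 hdisj hs (this ▸ ht)
    · rw [codisjoint_iff]
      change _ ∪ _ = Set.univ
      rw [← Set.image_union, hun, himage]
  ext A hA
  rw [Measure.map_apply hγ.measurable hA,
    Measure.restrict_apply (hγ.measurable hA), ← hun, Set.inter_union_distrib_left,
    measure_union (hdisj.mono Set.inter_subset_right Set.inter_subset_right)
      ((hγ.measurable hA).inter measurableSet_Ioc),
    ← measure_inter_add_sdiff A hmeas, Set.sdiff_eq, hcompl,
    ← hausdorffMeasure_equatorShift_image Q 0 (s := equatorShift Q ⁻¹' A ∩ Set.Ioc 0 π)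
      (Set.inter_subset_right.trans (by rw [zero_add]; exact Set.Ioc_subset_Icc_self)),
    ← hausdorffMeasure_equatorShift_image Q π (s := equatorShift Q ⁻¹' A ∩ Set.Ioc π (2 * π))
      (Set.inter_subset_right.trans (by rw [← two_mul]; exact Set.Ioc_subset_Icc_self)),
    Set.image_preimage_inter, Set.image_preimage_inter]

/-! ### Polar coordinates around a point of the equator -/

/-- The cosine of the angle at `Q` between the great circle through `Q` and `P` and the equator. -/
noncomputable def dirCos (P : RoundSphere) (Q : equator) : ℝ :=
  inner ℝ P.val (equatorShift Q (π / 2)).1.val / sin (dist P Q)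

section OpenHemisphere

variable {P P' : RoundSphere} (Q : equator)

theorem dist_mem_Ioo (hP : P ∉ equator) : dist P Q ∈ Set.Ioo 0 π := by
  refine ⟨dist_pos.2 fun h => hP (h ▸ Q.2), (dist_mem_Icc _ _).2.lt_of_ne fun h => hP ?_⟩
  have h1 := cos_dist P Q
  rw [h, cos_pi] at h1
  have h2 := inner_val_eq_frame P P Q
  have h3 : inner ℝ P.val P.val = 1 := by rw [real_inner_self_eq_norm_sq, P.norm_val, one_pow]
  rw [h3, ← h1] at h2
  change P.val 2 = 0
  nlinarith [sq_nonneg (inner ℝ P.val (equatorShift Q (π / 2)).1.val)]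

theorem dirCos_mul_sin (hP : P ∉ equator) :
    dirCos P Q * sin (dist P Q) = inner ℝ P.val (equatorShift Q (π / 2)).1.val :=
  div_mul_cancel₀ _ (sin_pos_of_mem_Ioo (dist_mem_Ioo Q hP)).ne'

theorem height_sq (hP : P ∉ equator) :
    P.val 2 ^ 2 = (1 - dirCos P Q ^ 2) * sin (dist P Q) ^ 2 := by
  have h2 := inner_val_eq_frame P P Q
  rw [real_inner_self_eq_norm_sq, P.norm_val, ← cos_dist, ← dirCos_mul_sin Q hP] at h2
  linear_combination -h2 - sin_sq_add_cos_sq (dist P Q)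

theorem dirCos_sq_lt_one (hP : P ∉ equator) : dirCos P Q ^ 2 < 1 := by
  have h1 : 0 < P.val 2 ^ 2 := sq_pos_of_ne_zero hP
  rw [height_sq Q hP] at h1
  have := pos_of_mul_pos_left h1 (sq_nonneg _)
  linarith

theorem inner_equatorShift_eq_cosSide (hP : P ∉ equator) (s : ℝ) :
    inner ℝ P.val (equatorShift Q s).1.val = cosSide (dist P Q) (dirCos P Q) s := by
  rw [inner_equatorShift, ← cos_dist, ← dirCos_mul_sin Q hP, cosSide]
  ring

theorem cosDistEquator_eq (hP : P ∉ equator) :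
    cosDistEquator P = cosSideMax (dist P Q) (dirCos P Q) := by
  set r := dist P Q with hr
  set c := dirCos P Q with hc
  have ha := cosSideMax_nonneg r c
  have hle : ∀ s, cosSide r c s ≤ cosSideMax r c := fun s => by
    have := cosSide_sq_add_cosSideDeriv_sq r c s
    exact le_of_sq_le_sq (by nlinarith [sq_nonneg (cosSideDeriv r c s)]) ha
  obtain ⟨t, ht⟩ : ∃ t, cosSide r c t = cosSideMax r c := by
    rcases ha.eq_or_lt with h | h
    -- With amplitude zero (`P` a pole), `X` vanishes identically and any `t` serves.
    · refine ⟨0, ?_⟩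
      have h1 := cosSide_sq_add_cosSideDeriv_sq r c 0
      rw [← h] at h1 ⊢
      nlinarith [sq_nonneg (cosSideDeriv r c 0)]
    · have h1 := cosSideMax_sq r c
      obtain ⟨t, -, hcos, hsin⟩ := exists_mem_Ioc_cos_sin
        (x := cos r / cosSideMax r c) (y := c * sin r / cosSideMax r c) (by
          field_simp; rw [h1])
      refine ⟨t, ?_⟩
      rw [cosSide, hcos, hsin]
      field_simp
      rw [h1]
  have h1 := cosSideMax_lt_one (dist_mem_Ioo Q hP) (dirCos_sq_lt_one Q hP)
  have hinf : Metric.infDist P equator = arccos (cosSideMax r c) := by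
    refine le_antisymm ?_ ?_
    · refine (Metric.infDist_le_dist_of_mem (equatorShift Q t).2).trans_eq ?_
      rw [dist_eq_arccos, inner_equatorShift_eq_cosSide Q hP, ← ht]
    · rw [Metric.le_infDist ⟨_, Q.2⟩]
      intro y hy
      obtain ⟨s, -, hs⟩ := exists_equatorShift_eq Q ⟨y, hy⟩
      have : y = (equatorShift Q s).1 := by rw [hs]
      rw [this, dist_eq_arccos, inner_equatorShift_eq_cosSide Q hP]
      exact arccos_le_arccos (hle s)
  rw [cosDistEquator, hinf, cos_arccos (by linarith) h1.le]

theorem distSecondDeriv_equatorShift (hP : P ∉ equator) (s : ℝ) :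
    distSecondDeriv P (equatorShift Q s) = sideDeriv2 (dist P Q) (dirCos P Q) s := by
  have hr := dist_mem_Ioo Q hP
  have hc := dirCos_sq_lt_one Q hP
  have h1 : ∀ t, dist P (equatorShift (equatorShift Q s) t).1 =
      arccos (cosSide (dist P Q) (dirCos P Q) (s + t)) := fun t => by
    rw [equatorShift_equatorShift, dist_eq_arccos, inner_equatorShift_eq_cosSide Q hP]
  simp only [distSecondDeriv, h1]
  rw [iteratedDeriv_succ, iteratedDeriv_one]
  have h2 : deriv (fun t => arccos (cosSide (dist P Q) (dirCos P Q) (s + t))) =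
      fun t => sideDeriv (dist P Q) (dirCos P Q) (s + t) := funext fun t =>
    ((hasDerivAt_arccos_cosSide hr hc (s + t)).comp_const_add s t).deriv
  rw [h2]
  have h3 := ((hasDerivAt_sideDeriv hr hc (s + 0)).comp_const_add s 0).deriv
  rwa [add_zero] at h3

theorem hemisphereDensity_equatorShift (hP : P ∉ equator) (s : ℝ) :
    hemisphereDensity P (equatorShift Q s) = sideDensity (dist P Q) (dirCos P Q) s := by
  rw [hemisphereDensity, sideDensity, distSecondDeriv_equatorShift Q hP,
    cosDistEquator_eq Q hP]

/-- The density depends on `Q` only through `dist P Q`. -/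
theorem measurable_hemisphereDensity (hP : P ∉ equator) : Measurable (hemisphereDensity P) := by
  have h : hemisphereDensity P = fun Q : equator =>
      1 / 2 * max ((1 - cosDistEquator P ^ 2) * cos (dist P Q) /
        ((1 - cos (dist P Q) ^ 2) * √(1 - cos (dist P Q) ^ 2))) 0
      + (1 - cosDistEquator P) / (2 * π) := by
    ext Q
    have h1 := hemisphereDensity_equatorShift Q hP 0
    rw [equatorShift_zero] at h1
    rw [h1, sideDensity, sideDeriv2, cosSide_zero, cosDistEquator_eq Q hP]
  rw [h]
  have h2 : Continuous fun Q : equator => dist P Q := by fun_prop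
  have h3 := h2.measurable
  fun_prop

/-- There is a great circle through `P` and `P'` and it meets the equator. -/
theorem exists_dirCos_eq (hP : 0 < P.val 2) (hP' : 0 < P'.val 2) :
    ∃ Q : equator, dirCos P Q = dirCos P' Q ∧ dist P P' = |dist P Q - dist P' Q| := by
  have hPe : P ∉ equator := hP.ne'
  have hPe' : P' ∉ equator := hP'.ne'
  obtain ⟨Q, hQ⟩ : ∃ Q : equator,
      P'.val 2 * inner ℝ P.val (equatorShift Q (π / 2)).1.val =
        P.val 2 * inner ℝ P'.val (equatorShift Q (π / 2)).1.val := by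
    -- The combination of `P` and `P'` of height zero; normalized, it is the point sought. It
    -- vanishes only if `P = P'`, and then any `Q` serves.
    set v := P'.val 2 • P.val - P.val 2 • P'.val with hv
    have hv2 : v 2 = 0 := by simp [hv, mul_comm]
    rcases eq_or_ne v 0 with h0 | h0
    · obtain ⟨Q⟩ : Nonempty equator :=
        ⟨⟨⟨!₂[1, 0, 0], by simp [EuclideanSpace.norm_eq, Fin.sum_univ_three]⟩, by simp [equator]⟩⟩
      refine ⟨Q, ?_⟩
      rw [← real_inner_smul_left, ← real_inner_smul_left, sub_eq_zero.1 h0]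
    · have hn := norm_ne_zero_iff.2 h0
      refine ⟨⟨⟨‖v‖⁻¹ • v, by rw [norm_smul, norm_inv, norm_norm, inv_mul_cancel₀ hn]⟩,
        by simp [equator, hv2]⟩, ?_⟩
      rw [← sub_eq_zero, ← real_inner_smul_left, ← real_inner_smul_left, ← inner_sub_left, ← hv]
      simp [PiLp.inner_apply, Fin.sum_univ_three, equatorShift, hv2]
      ring
  refine ⟨Q, ?_⟩
  have hr := dist_mem_Ioo Q hPe
  have hr' := dist_mem_Ioo Q hPe'
  have hs := sin_pos_of_mem_Ioo hr
  have hs' := sin_pos_of_mem_Ioo hr'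
  have hh := height_sq Q hPe
  have hh' := height_sq Q hPe'
  have hin := inner_val_eq_frame P P' Q
  rw [← dirCos_mul_sin Q hPe, ← dirCos_mul_sin Q hPe'] at hQ hin
  rw [← cos_dist, ← cos_dist, ← cos_dist] at hin
  set r := dist P Q
  set r' := dist P' Q
  set c := dirCos P Q
  set c' := dirCos P' Q
  have h1 : P.val 2 * sin r' = P'.val 2 * sin r := by
    refine (sq_eq_sq₀ (by positivity) (by positivity)).1 ?_
    have h2 : (P'.val 2 * (c * sin r)) ^ 2 = (P.val 2 * (c' * sin r')) ^ 2 := by rw [hQ]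
    linear_combination P'.val 2 ^ 2 * hh - P.val 2 ^ 2 * hh' - h2
  have h2 : c = c' := by
    refine mul_left_cancel₀ (mul_pos hP hs').ne' ?_
    linear_combination hQ + c * h1
  refine ⟨h2, ?_⟩
  have h3 : P.val 2 * P'.val 2 = (1 - c ^ 2) * sin r * sin r' := by
    refine mul_left_cancel₀ hs.ne' ?_
    linear_combination sin r' * hh - P.val 2 * h1
  have h4 : cos (dist P P') = cos |r - r'| := by
    rw [hin, h3, cos_abs, cos_sub, ← h2]; ring
  refine injOn_cos (dist_mem_Icc _ _) ⟨abs_nonneg _, ?_⟩ h4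
  rw [abs_le]; constructor <;> linarith [hr.1, hr.2, hr'.1, hr'.2]

end OpenHemisphere

/-! ### Quantile functions -/

theorem hasDerivAt_sideCdf {r c : ℝ} (hr : r ∈ Set.Ioo 0 π) (hc : c ^ 2 < 1) (s : ℝ) :
    HasDerivAt (sideCdf r c) (sideDensity r c s) s :=
  (continuous_sideDensity hr hc).integral_hasStrictDerivAt 0 s |>.hasDerivAt

theorem sideCdf_strictMono {r c : ℝ} (hr : r ∈ Set.Ioo 0 π) (hc : c ^ 2 < 1) :
    StrictMono (sideCdf r c) :=
  strictMono_of_hasDerivAt_pos (hasDerivAt_sideCdf hr hc) fun s => sideDensity_pos hr hc s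

/-- The quantile function, inverse to `sideCdf`. -/
noncomputable def sideQuantile (r c u : ℝ) : ℝ :=
  Function.invFunOn (sideCdf r c) (Set.Icc 0 (2 * π)) u

section Quantile

variable {r r' c : ℝ} {u : ℝ}

theorem exists_sideCdf_eq (hr : r ∈ Set.Ioo 0 π) (hc : c ^ 2 < 1) (hu : u ∈ Set.Icc 0 1) :
    ∃ s ∈ Set.Icc 0 (2 * π), sideCdf r c s = u := by
  have hcont : Continuous (sideCdf r c) :=
    continuous_iff_continuousAt.2 fun s => (hasDerivAt_sideCdf hr hc s).continuousAt
  have := intermediate_value_Icc two_pi_pos.le hcont.continuousOn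
  rw [sideCdf_zero, sideCdf_two_pi hr hc] at this
  exact this hu

theorem sideQuantile_mem (hr : r ∈ Set.Ioo 0 π) (hc : c ^ 2 < 1) (hu : u ∈ Set.Icc 0 1) :
    sideQuantile r c u ∈ Set.Icc 0 (2 * π) :=
  Function.invFunOn_mem (exists_sideCdf_eq hr hc hu)

theorem sideCdf_sideQuantile (hr : r ∈ Set.Ioo 0 π) (hc : c ^ 2 < 1) (hu : u ∈ Set.Icc 0 1) :
    sideCdf r c (sideQuantile r c u) = u :=
  Function.invFunOn_eq (exists_sideCdf_eq hr hc hu)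

theorem sideCdf_image_Ioc (hr : r ∈ Set.Ioo 0 π) (hc : c ^ 2 < 1) :
    sideCdf r c '' Set.Ioc 0 (2 * π) = Set.Ioc 0 1 := by
  have hm := sideCdf_strictMono hr hc
  ext u
  constructor
  · rintro ⟨s, hs, rfl⟩
    rw [← sideCdf_zero r c, ← sideCdf_two_pi hr hc]
    exact ⟨hm hs.1, hm.monotone hs.2⟩
  · intro hu
    obtain ⟨s, hs, rfl⟩ := exists_sideCdf_eq hr hc (Set.Ioc_subset_Icc_self hu)
    refine ⟨s, ⟨?_, hs.2⟩, rfl⟩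
    rw [← hm.lt_iff_lt, sideCdf_zero]; exact hu.1

theorem sideQuantile_sideCdf (hr : r ∈ Set.Ioo 0 π) (hc : c ^ 2 < 1) {s : ℝ}
    (hs : s ∈ Set.Icc 0 (2 * π)) : sideQuantile r c (sideCdf r c s) = s :=
  (sideCdf_strictMono hr hc).injective (Function.invFunOn_eq ⟨s, hs, rfl⟩)

theorem monotoneOn_sideQuantile (hr : r ∈ Set.Ioo 0 π) (hc : c ^ 2 < 1) :
    MonotoneOn (sideQuantile r c) (Set.Icc 0 1) := by
  intro u hu v hv h
  rw [← (sideCdf_strictMono hr hc).le_iff_le, sideCdf_sideQuantile hr hc hu,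
    sideCdf_sideQuantile hr hc hv]
  exact h

theorem aemeasurable_sideQuantile (hr : r ∈ Set.Ioo 0 π) (hc : c ^ 2 < 1) :
    AEMeasurable (sideQuantile r c) (volume.restrict (Set.Ioc 0 1)) :=
  aemeasurable_restrict_of_monotoneOn measurableSet_Ioc
    ((monotoneOn_sideQuantile hr hc).mono Set.Ioc_subset_Icc_self)

/-- Substitute `u = sideCdf r c s`: the quantile function pushes Lebesgue measure on the unit
interval to the measure with density `sideDensity`. -/
theorem lintegral_comp_sideQuantile (hr : r ∈ Set.Ioo 0 π) (hc : c ^ 2 < 1) (f : ℝ → ENNReal) :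
    ∫⁻ u in Set.Ioc 0 1, f (sideQuantile r c u) =
      ∫⁻ s in Set.Ioc 0 (2 * π), ENNReal.ofReal (sideDensity r c s) * f s := by
  rw [← sideCdf_image_Ioc hr hc, lintegral_image_eq_lintegral_abs_deriv_mul measurableSet_Ioc
    (fun s _ => (hasDerivAt_sideCdf hr hc s).hasDerivWithinAt)
    (sideCdf_strictMono hr hc).injective.injOn]
  refine setLIntegral_congr_fun measurableSet_Ioc fun s hs => ?_
  rw [sideQuantile_sideCdf hr hc (Set.Ioc_subset_Icc_self hs),
    abs_of_pos (sideDensity_pos hr hc s)]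

theorem sideQuantile_le_of_le (hr : r ∈ Set.Ioo 0 π) (hr' : r' ∈ Set.Ioo 0 π) (hc : c ^ 2 < 1)
    (hle : r ≤ r') (hu : u ∈ Set.Icc 0 1) (h : u ≤ (1 + c) / 2) :
    sideQuantile r c u ≤ sideQuantile r' c u ∧ sideQuantile r' c u ≤ π := by
  have h1 : sideQuantile r' c u ≤ π := by
    rw [← (sideCdf_strictMono hr' hc).le_iff_le, sideCdf_sideQuantile hr' hc hu,
      sideCdf_pi hr' hc]
    exact h
  refine ⟨?_, h1⟩
  rw [← (sideCdf_strictMono hr hc).le_iff_le, sideCdf_sideQuantile hr hc hu]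
  refine (sideCdf_sideQuantile hr' hc hu).symm.trans_le ?_
  exact sideCdf_antitoneOn hc ⟨(sideQuantile_mem hr' hc hu).1, h1⟩ hr hr' hle

theorem sideQuantile_le_of_ge (hr : r ∈ Set.Ioo 0 π) (hr' : r' ∈ Set.Ioo 0 π) (hc : c ^ 2 < 1)
    (hle : r ≤ r') (hu : u ∈ Set.Icc 0 1) (h : (1 + c) / 2 ≤ u) :
    π ≤ sideQuantile r' c u ∧ sideQuantile r' c u ≤ sideQuantile r c u := by
  have h1 : π ≤ sideQuantile r' c u := by
    rw [← (sideCdf_strictMono hr' hc).le_iff_le, sideCdf_sideQuantile hr' hc hu,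
      sideCdf_pi hr' hc]
    exact h
  refine ⟨h1, ?_⟩
  rw [← (sideCdf_strictMono hr hc).le_iff_le, sideCdf_sideQuantile hr hc hu]
  refine le_trans ?_ (sideCdf_sideQuantile hr' hc hu).le
  exact sideCdf_monotoneOn hc ⟨h1, (sideQuantile_mem hr' hc hu).2⟩ hr hr' hle

/-- Both quantiles lie in the same half circle, since the mass `(1 + c)/2` of the first half is the
same for `r` and `r'`; the one for `r` is the closer to `Q`. -/
theorem edist_equatorShift_sideQuantile (Q : equator) (hr : r ∈ Set.Ioo 0 π)
    (hr' : r' ∈ Set.Ioo 0 π) (hc : c ^ 2 < 1) (hle : r ≤ r') (hu : u ∈ Set.Icc 0 1) :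
    edist Q (equatorShift Q (sideQuantile r c u)) +
      edist (equatorShift Q (sideQuantile r c u)) (equatorShift Q (sideQuantile r' c u)) =
    edist Q (equatorShift Q (sideQuantile r' c u)) := by
  have hq := sideQuantile_mem hr hc hu
  have hq' := sideQuantile_mem hr' hc hu
  simp only [edist_dist]
  rw [← ENNReal.ofReal_add dist_nonneg dist_nonneg]
  congr 1
  rcases le_total u ((1 + c) / 2) with h | h
  · obtain ⟨h1, h2⟩ := sideQuantile_le_of_le hr hr' hc hle hu h
    have h3 : |sideQuantile r c u - sideQuantile r' c u| =
      sideQuantile r' c u - sideQuantile r c u := by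
        rw [abs_sub_comm, abs_of_nonneg (by linarith)]
    rw [dist_equatorShift_of_le_pi Q hq.1 (h1.trans h2), dist_equatorShift_of_le_pi Q hq'.1 h2,
      dist_equatorShift_equatorShift Q (h3.trans_le (by linarith [hq.1])), h3]
    ring
  · obtain ⟨h1, h2⟩ := sideQuantile_le_of_ge hr hr' hc hle hu h
    have h3 : |sideQuantile r c u - sideQuantile r' c u| =
      sideQuantile r c u - sideQuantile r' c u := abs_of_nonneg (by linarith)
    rw [dist_equatorShift_of_pi_le Q (h1.trans h2) hq.2, dist_equatorShift_of_pi_le Q h1 hq'.2,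
      dist_equatorShift_equatorShift Q (h3.trans_le (by linarith [hq.2])), h3]
    ring

end Quantile

/-! ### The measures of the embedding -/

/-- The measure on the circle representing a point of the open hemisphere. -/
noncomputable def hemisphereMeasure (P : RoundSphere) : Measure equator :=
  (Measure.hausdorffMeasure 1 : Measure equator).withDensity
    fun Q => ENNReal.ofReal (hemisphereDensity P Q)

section HemisphereMeasure

variable {P P' : RoundSphere} (Q : equator)

theorem lintegral_hemisphereMeasure (hP : P ∉ equator) {f : equator → ENNReal}
    (hf : Measurable f) : ∫⁻ x, f x ∂hemisphereMeasure P =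
      ∫⁻ s in Set.Ioc 0 (2 * π), ENNReal.ofReal (sideDensity (dist P Q) (dirCos P Q) s) *
        f (equatorShift Q s) := by
  have h1 := (measurable_hemisphereDensity hP).ennreal_ofReal
  rw [hemisphereMeasure, lintegral_withDensity_eq_lintegral_mul _ h1 hf,
    hausdorffMeasure_equator_eq_map Q, lintegral_map (h1.mul hf)
      (continuous_equatorShift Q).measurable]
  simp only [Pi.mul_apply, hemisphereDensity_equatorShift Q hP]

theorem aemeasurable_equatorShift_sideQuantile (hP : P ∉ equator) :
    AEMeasurable (fun u => equatorShift Q (sideQuantile (dist P Q) (dirCos P Q) u))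
      (volume.restrict (Set.Ioc 0 1)) :=
  (continuous_equatorShift Q).measurable.comp_aemeasurable
    (aemeasurable_sideQuantile (dist_mem_Ioo Q hP) (dirCos_sq_lt_one Q hP))

theorem hemisphereMeasure_eq_map (hP : P ∉ equator) : hemisphereMeasure P =
    (volume.restrict (Set.Ioc 0 1)).map
      fun u => equatorShift Q (sideQuantile (dist P Q) (dirCos P Q) u) := by
  refine Measure.ext_of_lintegral _ fun f hf => ?_
  rw [lintegral_map' hf.aemeasurable (aemeasurable_equatorShift_sideQuantile Q hP),
    lintegral_hemisphereMeasure Q hP hf,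
    lintegral_comp_sideQuantile (dist_mem_Ioo Q hP) (dirCos_sq_lt_one Q hP)
      fun s => f (equatorShift Q s)]

theorem isProbabilityMeasure_hemisphereMeasure (hP : P ∉ equator) :
    IsProbabilityMeasure (hemisphereMeasure P) := by
  obtain ⟨Q⟩ : Nonempty equator :=
    ⟨⟨⟨!₂[1, 0, 0], by simp [EuclideanSpace.norm_eq, Fin.sum_univ_three]⟩, by simp [equator]⟩⟩
  rw [hemisphereMeasure_eq_map Q hP]
  have : IsProbabilityMeasure (volume.restrict (Set.Ioc (0 : ℝ) 1)) := ⟨by simp⟩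
  exact Measure.isProbabilityMeasure_map (aemeasurable_equatorShift_sideQuantile Q hP)

theorem lintegral_edist_hemisphereMeasure (hP : P ∉ equator) :
    ∫⁻ x, edist Q x ∂hemisphereMeasure P = edist P Q := by
  have hr := dist_mem_Ioo Q hP
  have hc := dirCos_sq_lt_one Q hP
  have hd := continuous_sideDensity hr hc
  have hpi := pi_pos
  rw [lintegral_hemisphereMeasure Q hP (by fun_prop)]
  have hcont : Continuous fun s =>
      sideDensity (dist P Q) (dirCos P Q) s * dist Q (equatorShift Q s) := by
    have := continuous_equatorShift Q
    fun_prop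
  have h1 : ∫⁻ s in Set.Ioc 0 (2 * π), ENNReal.ofReal (sideDensity (dist P Q) (dirCos P Q) s) *
        edist Q (equatorShift Q s) = ENNReal.ofReal (∫ s in (0 : ℝ)..2 * π,
          sideDensity (dist P Q) (dirCos P Q) s * dist Q (equatorShift Q s)) := by
    rw [integral_of_le two_pi_pos.le, ofReal_integral_eq_lintegral_ofReal]
    · simp only [ENNReal.ofReal_mul (sideDensity_pos hr hc _).le, edist_dist]
    · exact (hcont.intervalIntegrable 0 (2 * π)).1
    · exact .of_forall fun s => mul_nonneg (sideDensity_pos hr hc s).le dist_nonneg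
  rw [h1, edist_dist, ← integral_add_adjacent_intervals (b := π)
    (hcont.intervalIntegrable _ _) (hcont.intervalIntegrable _ _)]
  congr 1
  have h2 : ∫ s in (0 : ℝ)..π, sideDensity (dist P Q) (dirCos P Q) s * dist Q (equatorShift Q s) =
      ∫ s in (0 : ℝ)..π, s * sideDensity (dist P Q) (dirCos P Q) s := by
    refine integral_congr fun s hs => ?_
    rw [Set.uIcc_of_le hpi.le] at hs
    rw [dist_equatorShift_of_le_pi Q hs.1 hs.2, mul_comm]
  -- The second half circle, read backwards from `Q`, is a first half circle for `-c`.
  have h3 : ∫ s in π..2 * π, sideDensity (dist P Q) (dirCos P Q) s * dist Q (equatorShift Q s) =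
      ∫ s in π..2 * π, (2 * π - s) * sideDensity (dist P Q) (-dirCos P Q) (2 * π - s) := by
    refine integral_congr fun s hs => ?_
    rw [Set.uIcc_of_le (by linarith)] at hs
    rw [dist_equatorShift_of_pi_le Q hs.1 hs.2, mul_comm, sub_eq_neg_add, sideDensity_add_two_pi,
      sideDensity_neg_neg]
  rw [h2, h3, integral_comp_sub_left
    (fun s => s * sideDensity (dist P Q) (-dirCos P Q) s) (2 * π), sub_self,
    show 2 * π - π = π by ring]
  exact integral_mul_sideDensity hr hc

end HemisphereMeasure

/-! ### Generalities on the Wasserstein distance -/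

section Wasserstein

variable {X : Type*} [MetricSpace X] [SecondCountableTopology X] [MeasurableSpace X]
    [BorelSpace X]

theorem wassersteinDist_comm (μ ν : Measure X) : wassersteinDist μ ν = wassersteinDist ν μ := by
  have key : ∀ μ ν : Measure X, wassersteinDist μ ν ≤ wassersteinDist ν μ := by
    intro μ ν
    refine le_iInf₂ fun K hK => ?_
    refine (iInf₂_le (K.map Prod.swap) ?_).trans ?_
    · refine ⟨?_, ?_⟩
      · rw [Measure.map_map measurable_fst measurable_swap]; exact hK.2
      · rw [Measure.map_map measurable_snd measurable_swap]; exact hK.1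
    · rw [lintegral_map measurable_edist measurable_swap]
      simp [edist_comm]
  exact le_antisymm (key μ ν) (key ν μ)

/-- The easy half of Kantorovich duality, for the 1-Lipschitz function `edist x`. -/
theorem lintegral_edist_le_add_wassersteinDist (x : X) (μ ν : Measure X) :
    ∫⁻ y, edist x y ∂ν ≤ ∫⁻ y, edist x y ∂μ + wassersteinDist μ ν := by
  simp only [wassersteinDist, ENNReal.add_iInf]
  refine le_iInf₂ fun K hK => ?_
  have hm : Measurable fun y => edist x y := by fun_prop
  rw [← hK.1, ← hK.2, lintegral_map hm measurable_fst, lintegral_map hm measurable_snd,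
    ← lintegral_add_left (f := fun p : X × X => edist x p.1) (hm.comp measurable_fst)]
  exact lintegral_mono fun p => edist_triangle _ _ _

theorem wassersteinDist_dirac_left (x : X) (ν : Measure X) [IsProbabilityMeasure ν] :
    wassersteinDist (Measure.dirac x) ν = ∫⁻ y, edist x y ∂ν := by
  refine le_antisymm ?_ ?_
  · refine (iInf₂_le (ν.map fun y => (x, y)) ?_).trans ?_
    · refine ⟨?_, ?_⟩
      · rw [Measure.map_map measurable_fst (by fun_prop)]
        exact (Measure.map_const ν x).trans (by simp)
      · rw [Measure.map_map measurable_snd (by fun_prop)]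
        exact Measure.map_id
    · rw [lintegral_map measurable_edist (by fun_prop)]
  · have := lintegral_edist_le_add_wassersteinDist x (Measure.dirac x) ν
    rwa [lintegral_dirac' x (by fun_prop), edist_self, zero_add] at this

theorem wassersteinDist_map_le {Ω : Type*} [MeasurableSpace Ω] {μ : Measure Ω} {f g : Ω → X}
    (hf : AEMeasurable f μ) (hg : AEMeasurable g μ) :
    wassersteinDist (μ.map f) (μ.map g) ≤ ∫⁻ ω, edist (f ω) (g ω) ∂μ := by
  refine (iInf₂_le (μ.map fun ω => (f ω, g ω)) ?_).trans ?_
  · refine ⟨?_, ?_⟩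
    · rw [AEMeasurable.map_map_of_aemeasurable measurable_fst.aemeasurable (hf.prodMk hg)]; rfl
    · rw [AEMeasurable.map_map_of_aemeasurable measurable_snd.aemeasurable (hf.prodMk hg)]; rfl
  · rw [lintegral_map' measurable_edist.aemeasurable (hf.prodMk hg)]

end Wasserstein

/-! ### The isometry -/

theorem wassersteinDist_hemisphereMeasure {P P' : RoundSphere} (hP : 0 < P.val 2)
    (hP' : 0 < P'.val 2) :
    wassersteinDist (hemisphereMeasure P) (hemisphereMeasure P') = edist P P' := by
  obtain ⟨Q, hc, hd⟩ := exists_dirCos_eq hP hP'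
  wlog hle : dist P Q ≤ dist P' Q generalizing P P'
  · rw [wassersteinDist_comm, edist_comm]
    exact this hP' hP hc.symm (by rw [dist_comm, hd, abs_sub_comm]) (not_le.1 hle).le
  have hPe : P ∉ equator := hP.ne'
  have hPe' : P' ∉ equator := hP'.ne'
  have hr := dist_mem_Ioo Q hPe
  have hr' := dist_mem_Ioo Q hPe'
  have hc1 := dirCos_sq_lt_one Q hPe
  have hadd : edist P Q + edist P P' = edist P' Q := by
    simp only [edist_dist]
    rw [← ENNReal.ofReal_add dist_nonneg dist_nonneg, hd, abs_sub_comm,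
      abs_of_nonneg (sub_nonneg.2 hle), add_sub_cancel]
  have hI := lintegral_edist_hemisphereMeasure Q hPe
  have hI' := lintegral_edist_hemisphereMeasure Q hPe'
  refine le_antisymm ?_ ?_
  · have hm := aemeasurable_equatorShift_sideQuantile Q hPe
    have hm' := aemeasurable_equatorShift_sideQuantile Q hPe'
    have hQ : Measurable fun y => edist Q y := by fun_prop
    have h1 := hemisphereMeasure_eq_map Q hPe
    have h1' := hemisphereMeasure_eq_map Q hPe'
    rw [h1, lintegral_map' hQ.aemeasurable hm] at hI
    rw [h1', lintegral_map' hQ.aemeasurable hm'] at hI'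
    rw [h1, h1']
    refine (wassersteinDist_map_le hm hm').trans ?_
    -- Adding the finite distance from `P` to `Q` avoids truncated subtraction: the cost bound
    -- becomes the integral of the pointwise equality along the quantile coupling.
    refine (ENNReal.add_le_add_iff_left (edist_ne_top P Q)).1 ?_
    rw [hadd, ← hI, ← hI',
      ← lintegral_add_left' (f := fun u => edist Q
        (equatorShift Q (sideQuantile (dist P Q) (dirCos P Q) u))) (hQ.comp_aemeasurable hm)]
    refine setLIntegral_mono' measurableSet_Ioc fun u hu => ?_
    rw [← hc]
    exact (edist_equatorShift_sideQuantile Q hr hr' hc1 hle (Set.Ioc_subset_Icc_self hu)).le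
  · refine (ENNReal.add_le_add_iff_left (edist_ne_top P Q)).1 ?_
    rw [hadd, ← hI, ← hI']
    exact lintegral_edist_le_add_wassersteinDist Q _ _

open Classical in
/-- The measure on the circle representing a point of the closed hemisphere. -/
noncomputable def closedHemisphereMeasure (P : RoundSphere) : Measure equator :=
  if hP : P ∈ equator then Measure.dirac ⟨P, hP⟩ else hemisphereMeasure P

theorem closedHemisphereMeasure_of_mem {P : RoundSphere} (hP : P ∈ equator) :
    closedHemisphereMeasure P = Measure.dirac ⟨P, hP⟩ := dif_pos hP

theorem closedHemisphereMeasure_of_notMem {P : RoundSphere} (hP : P ∉ equator) :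
    closedHemisphereMeasure P = hemisphereMeasure P := dif_neg hP

instance (P : RoundSphere) : IsProbabilityMeasure (closedHemisphereMeasure P) := by
  by_cases hP : P ∈ equator
  · rw [closedHemisphereMeasure_of_mem hP]; infer_instance
  · rw [closedHemisphereMeasure_of_notMem hP]; exact isProbabilityMeasure_hemisphereMeasure hP

theorem wassersteinDist_dirac_closedHemisphereMeasure (P : RoundSphere) (Q : equator) :
    wassersteinDist (Measure.dirac Q) (closedHemisphereMeasure P) = edist Q.1 P := by
  rw [wassersteinDist_dirac_left, edist_comm]
  by_cases hP : P ∈ equator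
  · rw [closedHemisphereMeasure_of_mem hP, lintegral_dirac' _ (by fun_prop), edist_comm]; rfl
  · rw [closedHemisphereMeasure_of_notMem hP, lintegral_edist_hemisphereMeasure Q hP]

theorem wassersteinDist_closedHemisphereMeasure {P P' : RoundSphere} (hP : P ∈ hemisphere)
    (hP' : P' ∈ hemisphere) :
    wassersteinDist (closedHemisphereMeasure P) (closedHemisphereMeasure P') = edist P P' := by
  by_cases h : P ∈ equator
  · rw [closedHemisphereMeasure_of_mem h, wassersteinDist_dirac_closedHemisphereMeasure]
  by_cases h' : P' ∈ equator
  · rw [wassersteinDist_comm, closedHemisphereMeasure_of_mem h',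
      wassersteinDist_dirac_closedHemisphereMeasure, edist_comm]
  rw [closedHemisphereMeasure_of_notMem h, closedHemisphereMeasure_of_notMem h']
  exact wassersteinDist_hemisphereMeasure (lt_of_le_of_ne hP (Ne.symm h))
    (lt_of_le_of_ne hP' (Ne.symm h'))

/-- The embedding of the closed hemisphere into Wasserstein space. -/
noncomputable def hemisphereEmbedding (P : hemisphere) : WassersteinSpace equator where
  toMeasure := closedHemisphereMeasure P
  isProbabilityMeasure := inferInstance
  exists_dist_lt_top := by
    refine ⟨⟨⟨!₂[1, 0, 0], by simp [EuclideanSpace.norm_eq, Fin.sum_univ_three]⟩,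
      by simp [equator]⟩, ?_⟩
    rw [wassersteinDist_comm, wassersteinDist_dirac_closedHemisphereMeasure]
    exact edist_lt_top _ _

theorem proposition1p5 :
    ∃ ι : hemisphere → WassersteinSpace equator,
      (∀ P P' : hemisphere,
        wassersteinDist (ι P).toMeasure (ι P').toMeasure = edist P P') ∧
      (∀ (P : hemisphere) (hP : (P : RoundSphere) ∈ equator),
        (ι P).toMeasure = MeasureTheory.Measure.dirac (⟨(P : RoundSphere), hP⟩ : equator)) ∧
      (∀ P : hemisphere, (P : RoundSphere) ∉ equator →
        (ι P).toMeasure = (MeasureTheory.Measure.hausdorffMeasure 1 :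
            MeasureTheory.Measure equator).withDensity
          (fun Q => ENNReal.ofReal (hemisphereDensity (P : RoundSphere) Q))) :=
  ⟨hemisphereEmbedding, fun P P' => wassersteinDist_closedHemisphereMeasure P.2 P'.2,
    fun _ hP => closedHemisphereMeasure_of_mem hP,
    fun _ hP => closedHemisphereMeasure_of_notMem hP⟩
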